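/- Let $0\le k<n$ be integers and let $W\subseteq\mathbb{R}^n$ be a $(k+1)$-dimensional subspace that is totally positive, i.e. $W$ is the row span of a real $(k+1)\times n$ matrix all of whose maximal minors are positive. Let $\mathrm{Gr}^{\ge 0}_{k,n}$ be the set of $k$-dimensional subspaces of $\mathbb{R}^n$ that are row spans of $k\times n$ matrices with nonnegative maximal minors (Plücker coordinates). The ($m=1$) amplituhedron is $\mathcal{B}_{n,k,1}(W)=\{V^\perp\cap W: V\in \mathrm{Gr}^{\ge 0}_{k,n}\}\subseteq\mathbb{P}(W)$. Let $D\in\overline{\mathcal{D}_{n,k,1}}$, i.e. $D$ is a Le-diagram (a Young diagram contained in a $k\times(n-k)$ rectangle, filled with $0$'s and $+$'s so that no $0$ has both a $+$ above it in its column and a $+$ to its left in its row) such that each row contains at most one $+$, and each $+$ is at the right end of its row. The southeast border of $D$ is the path of $n$ unit steps from the northeast to the southwest corner of the rectangle; label its steps $1,\dots,n$ in this order, and let $h_1<\dots<h_{n-k}$ be the labels of the horizontal steps. Attach the following data to $D$. * The partition of $[n]=\{1,\dots,n\}$ into the nonempty intervals $E_1,\dots,E_{n-k}$, where $E_j=\{h_{j-1}+1,\dots,h_j\}$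 for $j<n-k$ (with $h_0=0$) and $E_{n-k}=\{h_{n-k-1}+1,\dots,n\}$; and the set $C\subseteq[n]$ of labels of the vertical steps in the rows of $D$ (possibly empty rows) that contain no $+$. The matroid $M(D)$ on $[n]$ is the direct sum $M_1\oplus\dots\oplus M_{n-k}$, where $M_j$ has ground set $E_j$, the elements of $E_j\cap C$ are coloops of $M_j$, and the restriction of $M_j$ to $E_j\setminus C$ is uniform of rank $|E_j\setminus C|-1$. More generally, a pair $(E_1\sqcup\cdots\sqcup E_{n-k},C)$, consisting of a partition of $[n]$ into nonempty intervals in increasing order and a set $C\subseteq[n]$ with $E_j\setminus C\ne\emptyset$ for all $j$ and $\max(E_j)\notin C$ whenever $\max(E_j)\neq n$, is said to correspond to the matroid defined from it in the same way. * The cell $\mathcal{B}_D(W)=\{V^\perp\cap W: V\in S_{M(D)}\}$, where $S_{M(D)}\subseteq\mathrm{Gr}^{\ge0}_{k,n}$ is the set of $V$ whose Plücker coordinate $\Delta_I(V)$ is positive if $I$ is a basis of $M(D)$ and zero otherwise. * The sign vector $\sigma(D)\in\{0,+,-\}^n$: let $\hat\sigma_1=+$, and let $\hat\sigma_{i+1}=\hat\sigma_i$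 if $i$ labels a horizontal step and $\hat\sigma_{i+1}=-\hat\sigma_i$ otherwise; then $\sigma(D)_i=0$ if $i\in C$ and $\sigma(D)_i=\hat\sigma_i$ if $i\notin C$. For a sign vector $\sigma$, $\mathrm{var}(\sigma)$ is the number of sign changes, ignoring zeros (and $\mathrm{var}(0)=-1$). * The decorated permutation $\pi=\pi(D)$: replace each $+$ by an elbow joint (joining the east side of its box to the north side and the south side to the west side) and each $0$ by a cross, and give the edges of the north and west border the labels of the opposite steps of the southeast border. Then $\pi(i)=j$ if the pipe that starts at the step $i$ of the southeast border ends at the edge labelled $j$ of the northwest border. A fixed point is white if it labels vertical edges and black if it labels horizontal edges. An anti-excedance of $\pi$ is an $i$ with $\pi^{-1}(i)>i$ or such that $i$ is a white fixed point. Then the following are equivalent: (i) $\mathcal{B}_D(W)$ is contained in the interior of $\mathcal{B}_{n,k,1}(W)$ (as a subset of $\mathbb{P}(W)$); (ii) $D$ has $k$ nonempty rows, and for every $r\in[k]$ such that row $r$ of $D$ has no $+$, row $r-1$ of $D$ is longer than row $r$ (where row $0$ has length $n-k$); (iii) $\mathrm{var}(\sigma(D))=k$; (iv) $C\subseteq\{\min(E_1),\dots,\min(E_{n-k})\}\setminus\{1\}$,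 where $(E_1\sqcup\dots\sqcup E_{n-k},C)$ is the pair corresponding to $M(D)$; (v) if $i\in[n]$ is a white fixed point of $\pi$, then $2\le i\le n-1$ and $i-1$ is not an anti-excedance of $\pi$. -/

import Mathlib

open scoped LinearAlgebra.Projectivization

/-! ### Le-diagrams

The ground set `[n] = {1, …, n}` is modelled by `Fin n`: the element `i : Fin n` stands for the
number `i + 1`.  Rows (from top to bottom) and columns (from left to right) of diagrams are
numbered from `0`, and `(r, c)` is the box in row `r` and column `c`. -/

/-- A Le-diagram of type `(k, n)`: a Young diagram contained in the `k × (n - k)` rectangle whose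
boxes are filled with `0`'s and `+`'s (`plus` is the set of boxes with a `+`), such that no `0` has
both a `+` above it in its column and a `+` to its left in its row. -/
structure LeDiagram (k n : ℕ) where
  shape : YoungDiagram
  colLen_le : shape.colLen 0 ≤ k
  rowLen_le : shape.rowLen 0 ≤ n - k
  plus : Finset (ℕ × ℕ)
  plus_subset : plus ⊆ shape.cells
  le_property : ∀ r c : ℕ, (r, c) ∈ shape → (r, c) ∉ plus →
    ¬ ((∃ r' < r, (r', c) ∈ plus) ∧ (∃ c' < c, (r, c') ∈ plus))

namespace LeDiagram

variable {k n : ℕ}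

/-- Membership in the class of Le-diagrams each of whose rows has at most one `+`, every `+` being
at the right end of its row. -/
def InDBar (D : LeDiagram k n) : Prop :=
  (∀ r c c' : ℕ, (r, c) ∈ D.plus → (r, c') ∈ D.plus → c = c') ∧
    ∀ r c : ℕ, (r, c) ∈ D.plus → c + 1 = D.shape.rowLen r

/-- Row `r` contains no `+`. -/
def RowHasNoPlus (D : LeDiagram k n) (r : ℕ) : Prop := ∀ c : ℕ, (r, c) ∉ D.plus

theorem rowLen_le' (D : LeDiagram k n) (r : ℕ) : D.shape.rowLen r ≤ n - k :=
  (D.shape.rowLen_anti 0 r (Nat.zero_le _)).trans D.rowLen_le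

theorem colLen_le' (D : LeDiagram k n) (c : ℕ) : D.shape.colLen c ≤ k :=
  (D.shape.colLen_anti 0 c (Nat.zero_le _)).trans D.colLen_le

theorem lt_rowLen_iff (D : LeDiagram k n) (r c : ℕ) :
    c < D.shape.rowLen r ↔ r < D.shape.colLen c := by
  rw [← YoungDiagram.mem_iff_lt_rowLen, ← YoungDiagram.mem_iff_lt_colLen]

/-! ### The labelling of the southeast border

The southeast border is a path of `n` unit steps from the northeast corner to the southwest corner
of the `k × (n - k)` rectangle, with one vertical step in each of the `k` rows and one horizontal
step in each of the `n - k` columns. -/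

/-- The (zero-based) label of the vertical border step in row `r`: it is preceded by `r` vertical
steps and by the horizontal steps in the columns to its right. -/
def rowLabel (D : LeDiagram k n) (r : ℕ) : ℕ := r + (n - k - D.shape.rowLen r)

/-- The (zero-based) label of the horizontal border step in column `c`: it is preceded by the
vertical steps in the rows meeting that column and by the horizontal steps in the columns to its
right. -/
def colLabel (D : LeDiagram k n) (c : ℕ) : ℕ := D.shape.colLen c + (n - k - 1 - c)

theorem rowLabel_lt (D : LeDiagram k n) (hk : k ≤ n) (r : Fin k) : D.rowLabel r < n := by
  have := r.2
  unfold rowLabel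
  omega

theorem colLabel_lt (D : LeDiagram k n) (hk : k ≤ n) (c : Fin (n - k)) : D.colLabel c < n := by
  have := c.2
  have := D.colLen_le' c
  unfold colLabel
  omega

/-- The label of a border step; `Sum.inl r` is the vertical step in row `r` and `Sum.inr c` the
horizontal step in column `c`. -/
def label (D : LeDiagram k n) (hk : k ≤ n) : Fin k ⊕ Fin (n - k) → Fin n
  | Sum.inl r => ⟨D.rowLabel r, D.rowLabel_lt hk r⟩
  | Sum.inr c => ⟨D.colLabel c, D.colLabel_lt hk c⟩

theorem rowLabel_ne_colLabel (D : LeDiagram k n) (r : Fin k) (c : Fin (n - k)) :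
    D.rowLabel r ≠ D.colLabel c := by
  have hr := r.2
  have hc := c.2
  have h1 := D.rowLen_le' r
  have h2 := D.colLen_le' c
  have h3 := D.lt_rowLen_iff r c
  unfold rowLabel colLabel
  omega

theorem label_injective (D : LeDiagram k n) (hk : k ≤ n) : Function.Injective (D.label hk) := by
  rintro (r | c) (r' | c') h <;> simp only [label, Fin.mk.injEq] at h
  · congr 1
    apply Fin.ext
    have h1 := D.rowLen_le' r
    have h2 := D.rowLen_le' r'
    have h3 := D.shape.rowLen_anti r r'
    have h4 := D.shape.rowLen_anti r' r
    unfold rowLabel at h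
    omega
  · exact absurd h (D.rowLabel_ne_colLabel r c')
  · exact absurd h.symm (D.rowLabel_ne_colLabel r' c)
  · congr 1
    apply Fin.ext
    have h1 := c.2
    have h2 := c'.2
    have h3 := D.shape.colLen_anti c c'
    have h4 := D.shape.colLen_anti c' c
    unfold colLabel at h
    omega

/-- The labelling as a bijection between the border steps and `[n]`. -/
noncomputable def labelEquiv (D : LeDiagram k n) (hk : k ≤ n) : Fin k ⊕ Fin (n - k) ≃ Fin n :=
  Equiv.ofBijective (D.label hk)
    ((Fintype.bijective_iff_injective_and_card _).2
      ⟨D.label_injective hk, by simp; omega⟩)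

/-! ### The pipe dream and the decorated permutation -/

/-- Unit edges of the grid: `vert r c` is the vertical edge in row `r` with `c` boxes to its left,
`horiz r c` the horizontal edge in column `c` with `r` boxes above it. Pipes cross vertical
edges going west and horizontal edges going north. -/
inductive Edge where
  | vert (r c : ℕ)
  | horiz (r c : ℕ)

/-- The next edge of a pipe. In a box with a `+` (an elbow joint) the pipe turns: it goes from the
east side to the north side, or from the south side to the west side. In a box with a `0` (a cross)
it goes straight. There is no next edge on the north and the west border. -/
def nextEdge (D : LeDiagram k n) : Edge → Option Edge
  | .vert _ 0 => none
  | .vert r (c + 1) => some (if (r, c) ∈ D.plus then .horiz r c else .vert r c)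
  | .horiz 0 _ => none
  | .horiz (r + 1) c => some (if (r, c) ∈ D.plus then .vert r c else .horiz r c)

/-- `D.PipeFrom e e'`: the pipe that crosses the edge `e` later crosses the edge `e'` (or
`e = e'`). -/
def PipeFrom (D : LeDiagram k n) : Edge → Edge → Prop :=
  Relation.ReflTransGen fun e e' => D.nextEdge e = some e'

/-- The edge of the southeast border that is the given border step. -/
def borderEdge (D : LeDiagram k n) : Fin k ⊕ Fin (n - k) → Edge
  | Sum.inl r => .vert r (D.shape.rowLen r)
  | Sum.inr c => .horiz (D.shape.colLen c) c

/-- The edge of the west or north border opposite to the given step of the southeast border. -/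
def oppositeEdge : Fin k ⊕ Fin (n - k) → Edge
  | Sum.inl r => .vert r 0
  | Sum.inr c => .horiz 0 c

theorem oppositeEdge_injective :
    Function.Injective (oppositeEdge : Fin k ⊕ Fin (n - k) → Edge) := by
  rintro (r | c) (r' | c') h <;> simp [oppositeEdge] at h <;>
    simp [Fin.ext_iff, h]

theorem nextEdge_oppositeEdge (D : LeDiagram k n) (t : Fin k ⊕ Fin (n - k)) :
    D.nextEdge (oppositeEdge t) = none := by
  rcases t with r | c <;> simp [oppositeEdge, nextEdge]

theorem exists_exit_aux (D : LeDiagram k n) (m : ℕ) :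
    (∀ r c, r + c ≤ m → r < k → c ≤ n - k →
      ∃ t : Fin k ⊕ Fin (n - k), D.PipeFrom (.vert r c) (oppositeEdge t)) ∧
    (∀ r c, r + c ≤ m → r ≤ k → c < n - k →
      ∃ t : Fin k ⊕ Fin (n - k), D.PipeFrom (.horiz r c) (oppositeEdge t)) := by
  induction m with
  | zero =>
    refine ⟨fun r c h hr hc => ⟨Sum.inl ⟨r, hr⟩, ?_⟩, fun r c h hr hc => ⟨Sum.inr ⟨c, hc⟩, ?_⟩⟩
    · obtain rfl : c = 0 := by omega
      exact Relation.ReflTransGen.refl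
    · obtain rfl : r = 0 := by omega
      exact Relation.ReflTransGen.refl
  | succ m ih =>
    refine ⟨fun r c h hr hc => ?_, fun r c h hr hc => ?_⟩
    · rcases c with _ | c
      · exact ⟨Sum.inl ⟨r, hr⟩, Relation.ReflTransGen.refl⟩
      · by_cases hp : (r, c) ∈ D.plus
        · obtain ⟨t, ht⟩ := ih.2 r c (by omega) (by omega) (by omega)
          exact ⟨t, Relation.ReflTransGen.head (by simp [nextEdge, hp]) ht⟩
        · obtain ⟨t, ht⟩ := ih.1 r c (by omega) hr (by omega)
          exact ⟨t, Relation.ReflTransGen.head (by simp [nextEdge, hp]) ht⟩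
    · rcases r with _ | r
      · exact ⟨Sum.inr ⟨c, hc⟩, Relation.ReflTransGen.refl⟩
      · by_cases hp : (r, c) ∈ D.plus
        · obtain ⟨t, ht⟩ := ih.1 r c (by omega) (by omega) (by omega)
          exact ⟨t, Relation.ReflTransGen.head (by simp [nextEdge, hp]) ht⟩
        · obtain ⟨t, ht⟩ := ih.2 r c (by omega) (by omega) hc
          exact ⟨t, Relation.ReflTransGen.head (by simp [nextEdge, hp]) ht⟩

theorem exists_exit (D : LeDiagram k n) (s : Fin k ⊕ Fin (n - k)) :
    ∃ t : Fin k ⊕ Fin (n - k), D.PipeFrom (D.borderEdge s) (oppositeEdge t) := by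
  rcases s with r | c
  · exact (D.exists_exit_aux _).1 _ _ le_rfl r.2 (D.rowLen_le' r)
  · exact (D.exists_exit_aux _).2 _ _ le_rfl (D.colLen_le' c) c.2

/-- The step of the southeast border opposite to the edge at which the pipe originating at the
border step `s` ends. -/
noncomputable def pipeEnd (D : LeDiagram k n) (s : Fin k ⊕ Fin (n - k)) : Fin k ⊕ Fin (n - k) :=
  (D.exists_exit s).choose

theorem pipeFrom_pipeEnd (D : LeDiagram k n) (s : Fin k ⊕ Fin (n - k)) :
    D.PipeFrom (D.borderEdge s) (oppositeEdge (D.pipeEnd s)) :=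
  (D.exists_exit s).choose_spec

theorem nextEdge_injective (D : LeDiagram k n) {e e' f : Edge} (h : D.nextEdge e = some f)
    (h' : D.nextEdge e' = some f) : e = e' := by
  rcases e with ⟨r, _ | c⟩ | ⟨_ | r, c⟩ <;> rcases e' with ⟨r', _ | c'⟩ | ⟨_ | r', c'⟩ <;>
    simp only [nextEdge, Option.some.injEq, reduceCtorEq] at h h' <;>
    subst h <;> split_ifs at h' <;> simp_all

/-- The edge lies in the diagram or on its southeast border. -/
def EdgeInside (D : LeDiagram k n) : Edge → Prop
  | .vert r c => c ≤ D.shape.rowLen r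
  | .horiz r c => r ≤ D.shape.colLen c

theorem edgeInside_next (D : LeDiagram k n) {e f : Edge} (he : D.EdgeInside e)
    (h : D.nextEdge e = some f) : D.EdgeInside f := by
  rcases e with ⟨r, _ | c⟩ | ⟨_ | r, c⟩ <;>
    simp only [nextEdge, Option.some.injEq, reduceCtorEq] at h <;> subst h <;>
    simp only [EdgeInside] at he <;> have h3 := D.lt_rowLen_iff r c <;>
    split_ifs <;> simp only [EdgeInside] <;> omega

theorem edgeInside_of_pipeFrom (D : LeDiagram k n) {e f : Edge} (he : D.EdgeInside e)
    (h : D.PipeFrom e f) : D.EdgeInside f := by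
  induction h with
  | refl => exact he
  | tail _ hs ih => exact D.edgeInside_next ih hs

theorem edgeInside_borderEdge (D : LeDiagram k n) (s : Fin k ⊕ Fin (n - k)) :
    D.EdgeInside (D.borderEdge s) := by
  rcases s with r | c <;> simp [borderEdge, EdgeInside]

theorem not_next_borderEdge (D : LeDiagram k n) {e : Edge} (he : D.EdgeInside e)
    (s : Fin k ⊕ Fin (n - k)) : D.nextEdge e ≠ some (D.borderEdge s) := by
  intro h
  rcases s with r' | c' <;> rcases e with ⟨r, _ | c⟩ | ⟨_ | r, c⟩ <;>
    simp only [nextEdge, Option.some.injEq, reduceCtorEq, borderEdge] at h <;>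
    simp only [EdgeInside] at he <;> have h3 := D.lt_rowLen_iff r c <;>
    split_ifs at h <;> simp only [Edge.vert.injEq, Edge.horiz.injEq] at h <;>
    obtain ⟨h1, h2⟩ := h <;> subst h1 <;> subst h2 <;> omega

theorem pipeFrom_borderEdge (D : LeDiagram k n) {e : Edge} (he : D.EdgeInside e)
    {s : Fin k ⊕ Fin (n - k)} (h : D.PipeFrom e (D.borderEdge s)) : e = D.borderEdge s := by
  rcases Relation.ReflTransGen.cases_tail h with h | ⟨f, hf, hfs⟩
  · exact h.symm
  · exact absurd hfs (D.not_next_borderEdge (D.edgeInside_of_pipeFrom he hf) s)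

theorem pipeFrom_total (D : LeDiagram k n) {e e' f : Edge} (h : D.PipeFrom e f)
    (h' : D.PipeFrom e' f) : D.PipeFrom e e' ∨ D.PipeFrom e' e := by
  induction h using Relation.ReflTransGen.head_induction_on with
  | refl => exact Or.inr h'
  | head hs _ ih =>
    rcases ih with ih | ih
    · exact Or.inl (Relation.ReflTransGen.head hs ih)
    · rcases Relation.ReflTransGen.cases_tail ih with h1 | ⟨g, hg, hgs⟩
      · subst h1
        exact Or.inl (Relation.ReflTransGen.single hs)
      · rw [D.nextEdge_injective hs hgs]
        exact Or.inr hg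

theorem borderEdge_injective (D : LeDiagram k n) : Function.Injective D.borderEdge := by
  rintro (r | c) (r' | c') h <;> simp [borderEdge] at h <;> simp [Fin.ext_iff, h.1, h.2]

theorem pipeEnd_injective (D : LeDiagram k n) : Function.Injective D.pipeEnd := by
  intro s s' h
  have h1 := D.pipeFrom_pipeEnd s
  have h2 := D.pipeFrom_pipeEnd s'
  rw [← h] at h2
  apply D.borderEdge_injective
  rcases D.pipeFrom_total h1 h2 with h3 | h3
  · exact D.pipeFrom_borderEdge (D.edgeInside_borderEdge s) h3
  · exact (D.pipeFrom_borderEdge (D.edgeInside_borderEdge s') h3).symm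

end LeDiagram

/-- A decorated permutation of `[n]`: a permutation whose fixed points are coloured black or white;
`white` is the set of white fixed points. -/
structure DecoratedPermutation (n : ℕ) where
  perm : Equiv.Perm (Fin n)
  white : Set (Fin n)
  white_fixed : ∀ i ∈ white, perm i = i

/-- `i` is an anti-excedance of `π`: `π⁻¹(i) > i`, or `i` is a white fixed point. -/
def DecoratedPermutation.IsAntiExcedance {n : ℕ} (π : DecoratedPermutation n) (i : Fin n) : Prop :=
  i < π.perm.symm i ∨ i ∈ π.white

/-- The decorated permutation `π(D)`: the pipe originating at the step labelled `i` of the southeast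
border ends at the edge labelled `π(i)` of the northwest border, where opposite edges have the same
label; a fixed point is white if it labels vertical edges and black if it labels horizontal ones. -/
noncomputable def LeDiagram.decoratedPermutation {k n : ℕ} (D : LeDiagram k n) (hk : k ≤ n) :
    DecoratedPermutation n where
  perm := (D.labelEquiv hk).permCongr
    (Equiv.ofBijective D.pipeEnd (Finite.injective_iff_bijective.1 D.pipeEnd_injective))
  white := {i | ∃ r : Fin k, D.label hk (Sum.inl r) = i ∧ D.pipeEnd (Sum.inl r) = Sum.inl r}
  white_fixed := by
    rintro _ ⟨r, rfl, hr⟩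
    simp [Equiv.permCongr_apply, hr, LeDiagram.labelEquiv]

/-! ### Sign vectors -/

open Classical in
/-- The number of sign changes of a sign vector, ignoring zeros, with `var 0 = -1`. A sign change is
a pair of positions with opposite nonzero signs and only zeros in between. -/
noncomputable def signVar {n : ℕ} (σ : Fin n → SignType) : ℤ :=
  if σ = 0 then -1 else
    ((Finset.univ.filter fun p : Fin n × Fin n =>
      p.1 < p.2 ∧ σ p.1 ≠ 0 ∧ σ p.2 = -σ p.1 ∧ ∀ j, p.1 < j → j < p.2 → σ j = 0).card : ℤ)

namespace LeDiagram

variable {k n : ℕ}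

open Classical in
/-- The labels of the vertical border steps in the rows of `D` without a `+`. -/
noncomputable def zeroRowLabels (D : LeDiagram k n) : Finset (Fin n) :=
  Finset.univ.filter fun i => ∃ r < k, D.RowHasNoPlus r ∧ (i : ℕ) = D.rowLabel r

open Classical in
/-- The sign vector without zeros attached to the Young diagram of `D`: its first entry is `+`,
and consecutive entries `i`, `i + 1` agree if and only if `i` labels a horizontal step. -/
noncomputable def fullSign (D : LeDiagram k n) : ℕ → SignType
  | 0 => 1
  | i + 1 => if ∃ c < n - k, D.colLabel c = i then D.fullSign i else -D.fullSign i

/-- The sign vector `σ(D)`. -/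
noncomputable def signVector (D : LeDiagram k n) (i : Fin n) : SignType :=
  if i ∈ D.zeroRowLabels then 0 else D.fullSign i

end LeDiagram

/-! ### Pairs `(E_1 ⊔ ⋯ ⊔ E_l, C)` and their matroids -/

/-- A partition of `[n]` into nonempty intervals `E_1 < ⋯ < E_l` together with a set `C ⊆ [n]`, such
that `E_j \ C ≠ ∅` for all `j`, and `max E_j ∉ C` unless `max E_j` is the last element `n`. -/
structure IntervalPair (n l : ℕ) where
  E : Fin l → Finset (Fin n)
  C : Finset (Fin n)
  nonempty : ∀ j, (E j).Nonempty
  interval : ∀ j, (E j : Set (Fin n)).OrdConnected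
  increasing : ∀ j j', j < j' → ∀ a ∈ E j, ∀ b ∈ E j', a < b
  cover : ∀ i, ∃ j, i ∈ E j
  diff_nonempty : ∀ j, (E j \ C).Nonempty
  max_notMem : ∀ j i, IsGreatest (E j : Set (Fin n)) i → (i : ℕ) + 1 ≠ n → i ∉ C

/-- The set of bases of the matroid with ground set `E` in which the elements of `E ∩ C` are coloops
and whose restriction to `E \ C` is the uniform matroid of rank `|E \ C| - 1`. -/
def blockBases {n : ℕ} (E C : Finset (Fin n)) : Set (Finset (Fin n)) :=
  {B | B ⊆ E ∧ E ∩ C ⊆ B ∧ (B \ C).card = (E \ C).card - 1}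

/-- The matroid (given by its set of bases) of a pair: the direct sum of the matroids on the
blocks. -/
def IntervalPair.bases {n l : ℕ} (P : IntervalPair n l) : Set (Finset (Fin n)) :=
  {B | ∀ j, B ∩ P.E j ∈ blockBases (P.E j) P.C}

namespace LeDiagram

variable {k n : ℕ}

/-- The label `h_{j+1}` of the horizontal step number `j` (from `0`), counted from northeast to
southwest. -/
def horizLabel (D : LeDiagram k n) (j : ℕ) : ℕ := D.colLabel (n - k - 1 - j)

open Classical in
/-- The blocks `E_1 = {1, …, h_1}`, `E_j = {h_{j-1} + 1, …, h_j}`, and the last block, which extends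
up to `n`. -/
noncomputable def block (D : LeDiagram k n) (j : Fin (n - k)) : Finset (Fin n) :=
  Finset.univ.filter fun i =>
    ((j : ℕ) = 0 ∨ D.horizLabel (j - 1) < (i : ℕ)) ∧
      ((j : ℕ) + 1 = n - k ∨ (i : ℕ) ≤ D.horizLabel j)

theorem horizLabel_lt (D : LeDiagram k n) (hk : k < n) (j : ℕ) : D.horizLabel j < n := by
  have := D.colLen_le' (n - k - 1 - j)
  unfold horizLabel colLabel
  omega

theorem horizLabel_mono (D : LeDiagram k n) {j j' : ℕ} (h : j < j') (h' : j' < n - k) :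
    D.horizLabel j < D.horizLabel j' := by
  have := D.shape.colLen_anti (n - k - 1 - j') (n - k - 1 - j) (by omega)
  unfold horizLabel colLabel
  omega

theorem horizLabel_notMem (D : LeDiagram k n) {j : ℕ} (hj : j < n - k) {i : Fin n}
    (hi : (i : ℕ) = D.horizLabel j) : i ∉ D.zeroRowLabels := by
  simp only [zeroRowLabels, Finset.mem_filter, Finset.mem_univ, true_and, not_exists, not_and]
  intro r hr _ h
  exact D.rowLabel_ne_colLabel ⟨r, hr⟩ ⟨n - k - 1 - j, by omega⟩ (h.symm.trans hi)

theorem mem_block (D : LeDiagram k n) (j : Fin (n - k)) (i : Fin n) :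
    i ∈ D.block j ↔ ((j : ℕ) = 0 ∨ D.horizLabel (j - 1) < (i : ℕ)) ∧
      ((j : ℕ) + 1 = n - k ∨ (i : ℕ) ≤ D.horizLabel j) := by
  simp [block]

theorem horizLabel_mem_block (D : LeDiagram k n) (hk : k < n) (j : Fin (n - k)) :
    (⟨D.horizLabel j, D.horizLabel_lt hk j⟩ : Fin n) ∈ D.block j := by
  rw [mem_block]
  refine ⟨?_, Or.inr le_rfl⟩
  rcases Nat.eq_zero_or_pos (j : ℕ) with h | h
  · exact Or.inl h
  · exact Or.inr (D.horizLabel_mono (by omega) j.2)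

/-- The pair `(E_1 ⊔ ⋯ ⊔ E_{n-k}, C)` attached to `D`: the blocks are cut out by the horizontal
steps, and `C` is the set of labels of the vertical steps in rows without a `+`. -/
noncomputable def intervalPair (D : LeDiagram k n) (hk : k < n) : IntervalPair n (n - k) where
  E := D.block
  C := D.zeroRowLabels
  nonempty j := ⟨_, D.horizLabel_mem_block hk j⟩
  interval j := by
    refine ⟨fun a ha b hb c hc => ?_⟩
    simp only [Finset.mem_coe, mem_block] at ha hb ⊢
    have h1 : (a : ℕ) ≤ c := hc.1
    have h2 : (c : ℕ) ≤ b := hc.2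
    omega
  increasing j j' h a ha b hb := by
    simp only [mem_block] at ha hb
    have h1 : (j : ℕ) < j' := h
    have h2 := j'.2
    rw [Fin.lt_def]
    rcases Nat.lt_or_ge (j : ℕ) (j' - 1) with h3 | h3
    · have := D.horizLabel_mono h3 (by omega)
      omega
    · have h4 : (j' : ℕ) - 1 = j := by omega
      rw [h4] at hb
      omega
  cover i := by
    classical
    by_cases h : ∃ j, j < n - k ∧ (i : ℕ) ≤ D.horizLabel j
    · have hs := Nat.find_spec h
      refine ⟨⟨Nat.find h, hs.1⟩, ?_⟩
      rw [mem_block]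
      refine ⟨?_, Or.inr hs.2⟩
      rcases Nat.eq_zero_or_pos (Nat.find h) with h0 | h0
      · exact Or.inl h0
      · refine Or.inr (not_le.1 fun h1 => ?_)
        exact Nat.find_min h (m := Nat.find h - 1) (by omega) ⟨by omega, h1⟩
    · push Not at h
      refine ⟨⟨n - k - 1, by omega⟩, ?_⟩
      rw [mem_block]
      refine ⟨?_, Or.inl (by simp only; omega)⟩
      rcases Nat.eq_zero_or_pos (n - k - 1) with h0 | h0
      · exact Or.inl h0
      · exact Or.inr (h _ (by simp only; omega))
  diff_nonempty j := ⟨_, Finset.mem_sdiff.2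
    ⟨D.horizLabel_mem_block hk j, D.horizLabel_notMem j.2 rfl⟩⟩
  max_notMem j i hi hin := by
    have h1 := (D.mem_block j i).1 hi.1
    have h2 : D.horizLabel j ≤ (i : ℕ) := hi.2 (D.horizLabel_mem_block hk j)
    rcases h1.2 with h3 | h3
    · have h4 : (⟨n - 1, by omega⟩ : Fin n) ∈ D.block j := by
        rw [mem_block]
        refine ⟨?_, Or.inl h3⟩
        rcases h1.1 with h5 | h5
        · exact Or.inl h5
        · refine Or.inr (lt_of_lt_of_le h5 ?_)
          have := i.2
          simp only
          omega
      have h5 : n - 1 ≤ (i : ℕ) := hi.2 h4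
      have := i.2
      omega
    · exact D.horizLabel_notMem j.2 (le_antisymm h3 h2)

/-- The positroid `M(D)`, given by its set of bases. -/
noncomputable def positroid (D : LeDiagram k n) (hk : k < n) : Set (Finset (Fin n)) :=
  (D.intervalPair hk).bases

end LeDiagram

/-! ### The totally nonnegative Grassmannian and the amplituhedron -/

/-- The row span of a matrix, as a subspace of Euclidean space. -/
def rowSpan {d n : ℕ} (A : Matrix (Fin d) (Fin n) ℝ) : Submodule ℝ (EuclideanSpace ℝ (Fin n)) :=
  Submodule.span ℝ (Set.range fun i => WithLp.toLp 2 (A i))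

/-- The maximal minor of `A` in the column set `I`. -/
noncomputable def maxMinor {d n : ℕ} (A : Matrix (Fin d) (Fin n) ℝ) (I : Finset (Fin n))
    (hI : I.card = d) : ℝ :=
  (A.submatrix id (I.orderEmbOfFin hI)).det

/-- The totally positive part `Gr_{d,n}^{>0}` of the Grassmannian. -/
def posGrassmannian (d n : ℕ) : Set (Submodule ℝ (EuclideanSpace ℝ (Fin n))) :=
  {V | Module.finrank ℝ V = d ∧ ∃ A : Matrix (Fin d) (Fin n) ℝ, rowSpan A = V ∧
    ∀ (I : Finset (Fin n)) (hI : I.card = d), 0 < maxMinor A I hI}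

/-- The totally nonnegative Grassmannian `Gr_{d,n}^{≥0}`. -/
def nonnegGrassmannian (d n : ℕ) : Set (Submodule ℝ (EuclideanSpace ℝ (Fin n))) :=
  {V | Module.finrank ℝ V = d ∧ ∃ A : Matrix (Fin d) (Fin n) ℝ, rowSpan A = V ∧
    ∀ (I : Finset (Fin n)) (hI : I.card = d), 0 ≤ maxMinor A I hI}

/-- The positive Grassmann cell `S_M ⊆ Gr_{d,n}^{≥0}`: the Plücker coordinates indexed by `M` are
positive and all others are zero. -/
def grassmannCell (d n : ℕ) (M : Set (Finset (Fin n))) :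
    Set (Submodule ℝ (EuclideanSpace ℝ (Fin n))) :=
  {V | Module.finrank ℝ V = d ∧ ∃ A : Matrix (Fin d) (Fin n) ℝ, rowSpan A = V ∧
    ∀ (I : Finset (Fin n)) (hI : I.card = d),
      (I ∈ M → 0 < maxMinor A I hI) ∧ (I ∉ M → maxMinor A I hI = 0)}

/-- The quotient topology on a real projective space. -/
noncomputable instance projectivizationTopology (E : Type*) [AddCommGroup E] [Module ℝ E] [TopologicalSpace E] :
    TopologicalSpace (ℙ ℝ E) :=
  TopologicalSpace.coinduced (Projectivization.mk' ℝ : {v : E // v ≠ 0} → ℙ ℝ E) inferInstance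

/-- The set of points of `ℙ(W)` of the form `Vᗮ ∩ W` with `V ∈ S`. -/
def orthImage {n : ℕ} (W : Submodule ℝ (EuclideanSpace ℝ (Fin n)))
    (S : Set (Submodule ℝ (EuclideanSpace ℝ (Fin n)))) : Set (ℙ ℝ W) :=
  {p | ∃ V ∈ S, p.submodule.map W.subtype = Vᗮ ⊓ W}

/-- The `m = 1` amplituhedron `B_{n,k,1}(W) ⊆ ℙ(W)`. -/
def amplituhedron {n : ℕ} (k : ℕ) (W : Submodule ℝ (EuclideanSpace ℝ (Fin n))) : Set (ℙ ℝ W) :=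
  orthImage W (nonnegGrassmannian k n)

/-- The cell `B_D(W)` of the amplituhedron. -/
noncomputable def amplituhedronCell {k n : ℕ} (hk : k < n)
    (W : Submodule ℝ (EuclideanSpace ℝ (Fin n))) (D : LeDiagram k n) : Set (ℙ ℝ W) :=
  orthImage W (grassmannCell k n (D.positroid hk))

/-! ### Row spans and maximal minors -/

/-! A point of the cell is spanned by a nonzero `w` in `Vᗮ ⊓ W`, and everything rests on the signs
of `w`. A coloop `c` puts the unit vector of `c` into `V`, so `w` vanishes on `C`. Two elements `a`,
`b` of one block outside `C` give a vector of `V` supported on `{a, b}`, so `(-1)^i * w i` keeps its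
sign along `E_j \ C` (`apply_coloop_eq_zero`, `apply_block_relation`). Since `W` is totally positive
of dimension `k + 1`, `w` has at most `k` weak sign changes (`changes_lt_of_mem_rowSpan`). The steps
inside the `n - k` blocks already use up `k` of them, with zeros filled in to continue the pattern,
so there is no change between blocks. Hence off `C` the signs of `w` are, up to a global sign, those
of `altSign` (`exists_altSign_of_mem_cell`).

Two facts in the spirit of Gantmakher and Krein then detect the interior. A vector of `W` with `k +
1` strictly alternating entries gives a point of the amplituhedron, and this condition is open
(`mk_mem_interior_of_alternating`). A vector without zero entries orthogonal to a nonnegative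
`k`-dimensional subspace has at least `k` sign changes (`le_changes_of_mem_orthogonal`). If every
element of `C` is a block minimum other than the first index, its predecessor carries the sign lost
at the zero, and `k + 1` alternating entries survive. Otherwise some zero of `w` can be perturbed
inside `W` to the sign opposite to the pattern; fewer than `k` changes remain, so arbitrarily close
points lie outside the amplituhedron.

The combinatorial conditions are read off the border path. Each is compared with
`ZeroRowsFollowHoriz`: the vertical step of a row without `+` is neither first nor last and comes
right after a horizontal step. -/

theorem mem_rowSpan_iff {d n : ℕ} (A : Matrix (Fin d) (Fin n) ℝ) (w : EuclideanSpace ℝ (Fin n)) :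
    w ∈ rowSpan A ↔ ∃ x : Fin d → ℝ, ∀ i, w i = ∑ r, x r * A r i := by
  rw [rowSpan, Submodule.mem_span_range_iff_exists_fun]
  refine exists_congr fun x => ?_
  constructor
  · rintro rfl i
    simp
  · intro h
    ext i
    simp [h i]

theorem row_mem_rowSpan {d n : ℕ} (A : Matrix (Fin d) (Fin n) ℝ) (r : Fin d) :
    WithLp.toLp 2 (A r) ∈ rowSpan A :=
  Submodule.subset_span ⟨r, rfl⟩

/-- The Laplace expansion along an additional row that lies in the row span. -/
theorem sum_mul_det_succAbove_eq_zero {d n : ℕ} {A : Matrix (Fin d) (Fin n) ℝ}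
    {w : EuclideanSpace ℝ (Fin n)} (hw : w ∈ rowSpan A) (f : Fin (d + 1) → Fin n) :
    ∑ m : Fin (d + 1), (-1) ^ (m : ℕ) * w (f m) * (A.submatrix id (f ∘ m.succAbove)).det = 0 := by
  obtain ⟨x, hx⟩ := (mem_rowSpan_iff A w).1 hw
  let M : Matrix (Fin (d + 1)) (Fin (d + 1)) ℝ :=
    Matrix.of (Fin.cons (fun m => w (f m)) (fun r m => A r (f m)))
  have hM : M.det = 0 := by
    refine Matrix.exists_vecMul_eq_zero_iff.1 ⟨Fin.cons (-1) x, fun h => ?_, ?_⟩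
    · simpa using congrFun h 0
    · ext m
      simp [Matrix.vecMul, dotProduct, Fin.sum_univ_succ, M, hx]
  rw [← hM, Matrix.det_succ_row_zero]
  rfl

theorem maxMinor_eq_det {d n : ℕ} (A : Matrix (Fin d) (Fin n) ℝ) {I : Finset (Fin n)}
    (hI : I.card = d) {f : Fin d → Fin n} (hf : StrictMono f) (hfI : ∀ s, f s ∈ I) :
    maxMinor A I hI = (A.submatrix id f).det := by
  rw [maxMinor, Finset.orderEmbOfFin_unique hI hfI hf]

theorem exists_mem_rowSpan_of_det_ne_zero {d n : ℕ} {A : Matrix (Fin d) (Fin n) ℝ}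
    {f : Fin d → Fin n} (hf : (A.submatrix id f).det ≠ 0) (g : Fin d → ℝ) :
    ∃ v ∈ rowSpan A, ∀ s, v (f s) = g s := by
  set B := A.submatrix id f with hB
  have hB' : IsUnit B.det := isUnit_iff_ne_zero.2 hf
  refine ⟨WithLp.toLp 2 (Matrix.vecMul (Matrix.vecMul g B⁻¹) A), ?_, fun s => ?_⟩
  · rw [mem_rowSpan_iff]
    exact ⟨Matrix.vecMul g B⁻¹, fun i => rfl⟩
  · have h : Matrix.vecMul (Matrix.vecMul g B⁻¹) B = g := by
      rw [Matrix.vecMul_vecMul, Matrix.nonsing_inv_mul _ hB', Matrix.vecMul_one]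
    exact congrFun h s

theorem eq_zero_of_mem_rowSpan {d n : ℕ} {A : Matrix (Fin d) (Fin n) ℝ}
    {f : Fin d → Fin n} (hf : (A.submatrix id f).det ≠ 0) {w : EuclideanSpace ℝ (Fin n)}
    (hw : w ∈ rowSpan A) (h : ∀ s, w (f s) = 0) : w = 0 := by
  obtain ⟨x, hx⟩ := (mem_rowSpan_iff A w).1 hw
  have hx0 : x = 0 := by
    by_contra hne
    refine hf (Matrix.exists_vecMul_eq_zero_iff.1 ⟨x, hne, ?_⟩)
    ext s
    simpa [Matrix.vecMul, dotProduct] using (hx (f s)).symm.trans (h s)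
  ext i
  simp [hx, hx0]

/-! ### Plücker coordinates indexed by sets of columns, and two-term relations. -/

/-- The maximal minor of `A` in the column set `I`, extended by zero to all sets of columns. -/
noncomputable def plucker {d n : ℕ} (A : Matrix (Fin d) (Fin n) ℝ) (I : Finset (Fin n)) : ℝ :=
  if h : I.card = d then maxMinor A I h else 0

theorem plucker_eq {d n : ℕ} (A : Matrix (Fin d) (Fin n) ℝ) {I : Finset (Fin n)}
    (hI : I.card = d) : plucker A I = maxMinor A I hI := dif_pos hI

theorem exists_mem_rowSpan_of_plucker_ne_zero {d n : ℕ} {A : Matrix (Fin d) (Fin n) ℝ}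
    {I : Finset (Fin n)} (hI : plucker A I ≠ 0) (g : Fin n → ℝ) :
    ∃ v ∈ rowSpan A, ∀ i ∈ I, v i = g i := by
  have hc : I.card = d := by
    by_contra h
    exact hI (dif_neg h)
  rw [plucker_eq A hc] at hI
  obtain ⟨v, hv, h⟩ := exists_mem_rowSpan_of_det_ne_zero hI (fun s => g (I.orderEmbOfFin hc s))
  refine ⟨v, hv, fun i hi => ?_⟩
  obtain ⟨s, rfl⟩ : i ∈ Set.range (I.orderEmbOfFin hc) := by
    rw [Finset.range_orderEmbOfFin]
    exact hi
  exact h s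

theorem card_filter_lt_orderEmbOfFin {n d : ℕ} {J : Finset (Fin n)} (hJ : J.card = d)
    (m : Fin d) : (J.filter (· < J.orderEmbOfFin hJ m)).card = m := by
  have h : J.filter (· < J.orderEmbOfFin hJ m) =
      (Finset.Iio m).map (J.orderEmbOfFin hJ).toEmbedding := by
    ext i
    simp only [Finset.mem_filter, Finset.mem_map, Finset.mem_Iio]
    constructor
    · rintro ⟨h1, h2⟩
      obtain ⟨s, rfl⟩ : i ∈ Set.range (J.orderEmbOfFin hJ) := by
        rw [Finset.range_orderEmbOfFin]
        exact h1
      exact ⟨s, by simpa using h2, rfl⟩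
    · rintro ⟨s, h1, rfl⟩
      exact ⟨J.orderEmbOfFin_mem hJ s, by simpa using h1⟩
  rw [h, Finset.card_map, Fin.card_Iio]

/-- The Laplace expansion along an additional row, indexed by the elements of a set of columns. -/
theorem sum_mul_plucker_erase_eq_zero {d n : ℕ} {A : Matrix (Fin d) (Fin n) ℝ}
    {v : EuclideanSpace ℝ (Fin n)} (hv : v ∈ rowSpan A) {J : Finset (Fin n)}
    (hJ : J.card = d + 1) :
    ∑ i ∈ J, (-1) ^ (J.filter (· < i)).card * v i * plucker A (J.erase i) = 0 := by
  rw [← sum_mul_det_succAbove_eq_zero hv (J.orderEmbOfFin hJ)]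
  conv_lhs => rw [← Finset.map_orderEmbOfFin_univ J hJ, Finset.sum_map]
  refine Finset.sum_congr rfl fun m _ => ?_
  have hmem := J.orderEmbOfFin_mem hJ m
  have hc : (J.erase (J.orderEmbOfFin hJ m)).card = d := by
    rw [Finset.card_erase_of_mem hmem, hJ]
    rfl
  simp only [RelEmbedding.coe_toEmbedding, Finset.map_orderEmbOfFin_univ]
  rw [card_filter_lt_orderEmbOfFin, plucker_eq _ hc, maxMinor_eq_det A hc
    (f := J.orderEmbOfFin hJ ∘ m.succAbove)]
  · exact (J.orderEmbOfFin hJ).strictMono.comp (Fin.strictMono_succAbove m)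
  · intro s
    refine Finset.mem_erase.2 ⟨fun h => ?_, J.orderEmbOfFin_mem hJ _⟩
    exact Fin.succAbove_ne m s ((J.orderEmbOfFin hJ).injective h)

/-- If `v` in the row span of `A` is supported on two elements `a`, `b` of `J`, the expansion has two
terms. -/
theorem two_term_relation {d n : ℕ} {A : Matrix (Fin d) (Fin n) ℝ}
    {v : EuclideanSpace ℝ (Fin n)} (hv : v ∈ rowSpan A) {J : Finset (Fin n)}
    (hJ : J.card = d + 1) {a b : Fin n} (ha : a ∈ J) (hb : b ∈ J) (hab : a ≠ b)
    (h0 : ∀ i ∈ J, i ≠ a → i ≠ b → v i = 0) :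
    (-1) ^ (J.filter (· < a)).card * v a * plucker A (J.erase a) +
      (-1) ^ (J.filter (· < b)).card * v b * plucker A (J.erase b) = 0 := by
  refine (Finset.sum_pair (f := fun i => (-1) ^ (J.filter (· < i)).card * v i *
    plucker A (J.erase i)) hab).symm.trans ((Finset.sum_subset
      (by simp [Finset.insert_subset_iff, ha, hb]) fun i hi hi' => ?_).trans
      (sum_mul_plucker_erase_eq_zero hv hJ))
  simp only [Finset.mem_insert, Finset.mem_singleton, not_or] at hi'
  rw [h0 i hi hi'.1 hi'.2]
  ring

/-- If `J` contains the whole stretch from `a` to `b`, positions within `J` differ by exactly `b -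
a`. Signs depending on `J` can then be traded for the parities of `a` and `b` themselves. -/
theorem neg_one_pow_card_filter_lt {n : ℕ} {J : Finset (Fin n)} {a b : Fin n} (hab : a ≤ b)
    (h : Finset.Ico a b ⊆ J) :
    (-1 : ℝ) ^ (J.filter (· < b)).card =
      (-1) ^ (J.filter (· < a)).card * ((-1) ^ (a : ℕ) * (-1) ^ (b : ℕ)) := by
  have h1 : J.filter (· < b) = J.filter (· < a) ∪ Finset.Ico a b := by
    ext i
    simp only [Finset.mem_filter, Finset.mem_union, Finset.mem_Ico]
    constructor
    · rintro ⟨h2, h3⟩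
      by_cases h4 : i < a
      · exact Or.inl ⟨h2, h4⟩
      · exact Or.inr ⟨not_lt.1 h4, h3⟩
    · rintro (⟨h2, h3⟩ | ⟨h2, h3⟩)
      · exact ⟨h2, h3.trans_le hab⟩
      · exact ⟨h (Finset.mem_Ico.2 ⟨h2, h3⟩), h3⟩
  have h2 : Disjoint (J.filter (· < a)) (Finset.Ico a b) := by
    rw [Finset.disjoint_left]
    intro i hi hi'
    exact absurd (Finset.mem_filter.1 hi).2 (not_lt.2 (Finset.mem_Ico.1 hi').1)
  have h3 : (a : ℕ) + (b - a : ℕ) = b := Nat.add_sub_cancel' hab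
  rw [h1, Finset.card_union_of_disjoint h2, Fin.card_Ico, pow_add]
  congr 1
  conv_rhs => rw [← h3, pow_add, ← mul_assoc, ← pow_add, Even.neg_one_pow ⟨_, rfl⟩, one_mul]

/-- The two-term relation for elements `a`, `b` with all elements in between in `J`. -/
theorem two_term_relation' {d n : ℕ} {A : Matrix (Fin d) (Fin n) ℝ}
    {v : EuclideanSpace ℝ (Fin n)} (hv : v ∈ rowSpan A) {J : Finset (Fin n)}
    (hJ : J.card = d + 1) {a b : Fin n} (ha : a ∈ J) (hb : b ∈ J) (hab : a ≠ b)
    (h0 : ∀ i ∈ J, i ≠ a → i ≠ b → v i = 0) (hI : ∀ i, a ≤ i ∧ i ≤ b ∨ b ≤ i ∧ i ≤ a → i ∈ J) :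
    (-1) ^ (a : ℕ) * v a * plucker A (J.erase a) +
      (-1) ^ (b : ℕ) * v b * plucker A (J.erase b) = 0 := by
  have key : ∀ a b : Fin n, a ∈ J → b ∈ J → a < b → (∀ i ∈ J, i ≠ a → i ≠ b → v i = 0) →
      (∀ i, a ≤ i → i ≤ b → i ∈ J) → (-1) ^ (a : ℕ) * v a * plucker A (J.erase a) +
      (-1) ^ (b : ℕ) * v b * plucker A (J.erase b) = 0 := by
    intro a b ha hb hab h0 hI
    have h1 := two_term_relation hv hJ ha hb hab.ne h0
    rw [neg_one_pow_card_filter_lt hab.le fun i hi =>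
      hI i (Finset.mem_Ico.1 hi).1 (Finset.mem_Ico.1 hi).2.le] at h1
    have hs : ((-1 : ℝ) ^ (a : ℕ)) * (-1) ^ (a : ℕ) = 1 := by
      rw [← pow_add, Even.neg_one_pow ⟨_, rfl⟩]
    have ht : ((-1 : ℝ) ^ (J.filter (· < a)).card) * (-1) ^ (J.filter (· < a)).card = 1 := by
      rw [← pow_add, Even.neg_one_pow ⟨_, rfl⟩]
    linear_combination (-1 : ℝ) ^ (a : ℕ) * (-1) ^ (J.filter (· < a)).card * h1 -
      (-1) ^ (a : ℕ) * v a * plucker A (J.erase a) * ht -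
      (-1) ^ (b : ℕ) * v b * plucker A (J.erase b) * 
        ((-1 : ℝ) ^ (a : ℕ) * (-1) ^ (a : ℕ) * ht + hs)
  rcases lt_or_gt_of_ne hab with h | h
  · exact key a b ha hb h h0 fun i h1 h2 => hI i (Or.inl ⟨h1, h2⟩)
  · rw [add_comm]
    exact key b a hb ha h (fun i hi h1 h2 => h0 i hi h2 h1) fun i h1 h2 => hI i (Or.inr ⟨h1, h2⟩)

/-! ### Sign variation in totally positive subspaces -/

/-- A discrete intermediate value theorem: a sequence that rises by at most one per step skips no
value. -/
theorem exists_eq_of_le_of_succ_le {N : ℕ → ℕ} (h0 : N 0 = 0) (h1 : ∀ i, N (i + 1) ≤ N i + 1)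
    (i j : ℕ) (hj : j ≤ N i) : ∃ p ≤ i, N p = j := by
  induction i with
  | zero => exact ⟨0, le_rfl, by omega⟩
  | succ i ih =>
    rcases Nat.lt_or_ge (N i) j with h | h
    · exact ⟨i + 1, le_rfl, by have := h1 i; omega⟩
    · obtain ⟨p, hp, h⟩ := ih h
      exact ⟨p, by omega, h⟩

theorem det_submatrix_pos {d n : ℕ} {A : Matrix (Fin d) (Fin n) ℝ}
    (hA : ∀ (I : Finset (Fin n)) (hI : I.card = d), 0 < maxMinor A I hI) {f : Fin d → Fin n}
    (hf : StrictMono f) : 0 < (A.submatrix id f).det := by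
  have h : (Finset.univ.map ⟨f, hf.injective⟩).card = d := by simp
  rw [← maxMinor_eq_det A h hf fun s => by simp]
  exact hA _ h

/-- A nonzero vector of a totally positive subspace of dimension `d` has fewer than `d` weak sign
changes. -/
theorem variation_lt_of_mem_rowSpan {d n : ℕ} {A : Matrix (Fin d) (Fin n) ℝ}
    (hA : ∀ (I : Finset (Fin n)) (hI : I.card = d), 0 < maxMinor A I hI)
    {w : EuclideanSpace ℝ (Fin n)} (hw : w ∈ rowSpan A) (hw0 : w ≠ 0) {N : ℕ → ℕ} (h0 : N 0 = 0)
    (h1 : ∀ i, N (i + 1) ≤ N i + 1) (hmono : Monotone N) {s : ℝ} (hs : s ≠ 0)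
    (hN : ∀ i : Fin n, 0 ≤ s * (-1) ^ N i * w i) (i : Fin n) : N i < d := by
  by_contra! hi
  -- If `N` reached `d`, there would be positions where it takes each of the values `0, …, d`; there
  -- the weak signs of `w` alternate.
  have h2 : ∀ j : Fin (d + 1), ∃ p : Fin n, N p = j := fun j => by
    obtain ⟨p, hp, h⟩ := exists_eq_of_le_of_succ_le h0 h1 i j (by omega)
    exact ⟨⟨p, by omega⟩, h⟩
  choose f hf using h2
  have hfm : StrictMono f := fun a b hab => by
    by_contra! h
    have := hmono (Fin.le_def.1 h)
    rw [hf, hf] at this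
    exact absurd hab (not_lt.2 this)
  have hpos : ∀ m : Fin (d + 1), 0 < (A.submatrix id (f ∘ m.succAbove)).det := fun m =>
    det_submatrix_pos hA (hfm.comp (Fin.strictMono_succAbove m))
  have hsum := sum_mul_det_succAbove_eq_zero hw f
  -- Alternation makes all terms of the Laplace expansion weakly of one sign. Their sum is zero, so
  -- `w` vanishes at all the chosen positions; `d` of these already determine a vector of the row
  -- span.
  have hterm : ∀ m : Fin (d + 1),
      0 ≤ s * ((-1) ^ (m : ℕ) * w (f m) * (A.submatrix id (f ∘ m.succAbove)).det) := fun m => by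
    have := mul_nonneg (hN (f m)) (hpos m).le
    rw [hf] at this
    linarith
  have hsum' : ∑ m : Fin (d + 1),
      s * ((-1) ^ (m : ℕ) * w (f m) * (A.submatrix id (f ∘ m.succAbove)).det) = 0 := by
    rw [← Finset.mul_sum, hsum, mul_zero]
  have hz : ∀ m : Fin (d + 1), w (f m) = 0 := fun m => by
    have := (Finset.sum_eq_zero_iff_of_nonneg fun m _ => hterm m).1 hsum' m (Finset.mem_univ m)
    simpa [hs, (hpos m).ne'] using this
  exact hw0 (eq_zero_of_mem_rowSpan
    (det_submatrix_pos hA (hfm.comp (Fin.strictMono_succAbove (Fin.last d)))).ne' hw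
    fun s => hz _)

/-! ### Orthogonality -/

theorem mem_orthogonal_rowSpan_iff {n : ℕ} (V : Submodule ℝ (EuclideanSpace ℝ (Fin n)))
    (w : EuclideanSpace ℝ (Fin n)) : w ∈ Vᗮ ↔ ∀ v ∈ V, ∑ i, v i * w i = 0 := by
  rw [Submodule.mem_orthogonal]
  refine forall₂_congr fun v _ => ?_
  simp [PiLp.inner_apply, mul_comm]

/-! ### Blocks and transversals -/

namespace IntervalPair

variable {n l : ℕ}

/-- The index of the block containing `i`. -/
noncomputable def blk (P : IntervalPair n l) (i : Fin n) : Fin l := (P.cover i).choose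

theorem mem_blk (P : IntervalPair n l) (i : Fin n) : i ∈ P.E (P.blk i) := (P.cover i).choose_spec

theorem mem_E_iff (P : IntervalPair n l) {i : Fin n} {j : Fin l} : i ∈ P.E j ↔ P.blk i = j := by
  refine ⟨fun h => ?_, fun h => h ▸ P.mem_blk i⟩
  rcases lt_trichotomy (P.blk i) j with h1 | h1 | h1
  · exact absurd (P.increasing _ _ h1 i (P.mem_blk i) i h) (lt_irrefl i)
  · exact h1
  · exact absurd (P.increasing _ _ h1 i h i (P.mem_blk i)) (lt_irrefl i)

theorem blk_mono (P : IntervalPair n l) : Monotone P.blk := fun a b hab => by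
  by_contra! h
  exact absurd (P.increasing _ _ h b (P.mem_blk b) a (P.mem_blk a)) (not_lt.2 hab)

theorem blk_le_succ (P : IntervalPair n l) {a b : Fin n} (hab : (a : ℕ) + 1 = b) :
    (P.blk b : ℕ) ≤ P.blk a + 1 := by
  by_contra! h
  obtain ⟨i, hi⟩ := P.nonempty ⟨P.blk a + 1, h.trans (P.blk b).2⟩
  have h1 := P.increasing (P.blk a) ⟨P.blk a + 1, h.trans (P.blk b).2⟩ (by simp [Fin.lt_def])
    a (P.mem_blk a) i hi
  have h2 := P.increasing ⟨P.blk a + 1, h.trans (P.blk b).2⟩ (P.blk b) h i hi b (P.mem_blk b)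
  rw [Fin.lt_def] at h1 h2
  omega

theorem blk_zero (P : IntervalPair n l) {a : Fin n} (ha : (a : ℕ) = 0) : (P.blk a : ℕ) = 0 := by
  obtain ⟨i, hi⟩ := P.nonempty ⟨0, (P.blk a).pos⟩
  have h : P.blk a ≤ P.blk i := P.blk_mono (by rw [Fin.le_def]; omega)
  rw [P.mem_E_iff.1 hi] at h
  simpa [Fin.le_def] using h

theorem blk_last (P : IntervalPair n l) {a : Fin n} (ha : (a : ℕ) + 1 = n) :
    (P.blk a : ℕ) + 1 = l := by
  have hl := (P.blk a).2
  obtain ⟨i, hi⟩ := P.nonempty ⟨l - 1, by omega⟩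
  have h : P.blk i ≤ P.blk a := P.blk_mono (by rw [Fin.le_def]; omega)
  rw [P.mem_E_iff.1 hi, Fin.le_def] at h
  simp only at h
  omega

/-- A choice of one element outside `C` from each block. -/
def IsTransversal (P : IntervalPair n l) (x : Fin l → Fin n) : Prop :=
  ∀ j, x j ∈ P.E j ∧ x j ∉ P.C

theorem exists_isTransversal (P : IntervalPair n l) : ∃ x, P.IsTransversal x := by
  choose x hx using P.diff_nonempty
  exact ⟨x, fun j => Finset.mem_sdiff.1 (hx j)⟩

theorem IsTransversal.blk {P : IntervalPair n l} {x : Fin l → Fin n} (hx : P.IsTransversal x)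
    (j : Fin l) : P.blk (x j) = j := P.mem_E_iff.1 (hx j).1

theorem IsTransversal.injective {P : IntervalPair n l} {x : Fin l → Fin n}
    (hx : P.IsTransversal x) : Function.Injective x := fun j j' h => by
  rw [← hx.blk j, h, hx.blk]

theorem IsTransversal.update {P : IntervalPair n l} {x : Fin l → Fin n} (hx : P.IsTransversal x)
    {b : Fin n} (hb : b ∉ P.C) : P.IsTransversal (Function.update x (P.blk b) b) := fun j => by
  rcases eq_or_ne j (P.blk b) with rfl | h
  · simpa using ⟨P.mem_blk b, hb⟩
  · simpa [h] using hx j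

/-- The complement of a transversal. -/
def coTransversal (x : Fin l → Fin n) : Finset (Fin n) := Finset.univ.filter fun i => ∀ j, x j ≠ i

theorem mem_coTransversal {x : Fin l → Fin n} {i : Fin n} :
    i ∈ coTransversal x ↔ ∀ j, x j ≠ i := by simp [coTransversal]

theorem IsTransversal.mem_coTransversal_iff {P : IntervalPair n l} {x : Fin l → Fin n}
    (hx : P.IsTransversal x) {i : Fin n} : i ∈ coTransversal x ↔ x (P.blk i) ≠ i := by
  rw [mem_coTransversal]
  refine ⟨fun h => h _, fun h j hj => ?_⟩
  subst hj
  rw [hx.blk] at h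
  exact h rfl

theorem IsTransversal.card_coTransversal {P : IntervalPair n l} {x : Fin l → Fin n}
    (hx : P.IsTransversal x) {d : ℕ} (hd : d + l = n) : (coTransversal x).card = d := by
  have h : coTransversal x = (Finset.univ.map ⟨x, hx.injective⟩)ᶜ := by
    ext i
    simp [mem_coTransversal]
  rw [h, Finset.card_compl]
  simp
  omega

theorem IsTransversal.coTransversal_mem_bases {P : IntervalPair n l} {x : Fin l → Fin n}
    (hx : P.IsTransversal x) : coTransversal x ∈ P.bases := fun j => by
  refine ⟨Finset.inter_subset_right, fun c hc => ?_, ?_⟩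
  · obtain ⟨h1, h2⟩ := Finset.mem_inter.1 hc
    exact Finset.mem_inter.2 ⟨mem_coTransversal.2 fun j' h => (hx j').2 (h ▸ h2), h1⟩
  · rw [← Finset.card_erase_of_mem (Finset.mem_sdiff.2 (hx j))]
    congr 1
    ext i
    simp only [Finset.mem_sdiff, Finset.mem_inter, hx.mem_coTransversal_iff, Finset.mem_erase]
    constructor
    · rintro ⟨⟨h1, h2⟩, h3⟩
      rw [P.mem_E_iff.1 h2] at h1
      exact ⟨h1.symm, h2, h3⟩
    · rintro ⟨h1, h2, h3⟩
      rw [P.mem_E_iff.1 h2]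
      exact ⟨⟨h1.symm, h2⟩, h3⟩

theorem notMem_bases_of_coloop_notMem (P : IntervalPair n l) {I : Finset (Fin n)} {c : Fin n}
    (hc : c ∈ P.C) (hI : c ∉ I) : I ∉ P.bases := fun h =>
  hI (Finset.mem_inter.1 ((h (P.blk c)).2.1 (Finset.mem_inter.2 ⟨P.mem_blk c, hc⟩))).1

theorem notMem_bases_of_block_subset (P : IntervalPair n l) {I : Finset (Fin n)} {j : Fin l}
    (hI : ∀ i ∈ P.E j, i ∉ P.C → i ∈ I) : I ∉ P.bases := fun h => by
  have h1 := (h j).2.2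
  have h2 : (I ∩ P.E j) \ P.C = P.E j \ P.C := by
    ext i
    simp only [Finset.mem_sdiff, Finset.mem_inter]
    exact ⟨fun h => ⟨h.1.2, h.2⟩, fun h => ⟨⟨hI i h.1 h.2, h.1⟩, h.2⟩⟩
  rw [h2] at h1
  have := Finset.card_pos.2 (P.diff_nonempty j)
  omega

/-- A set of size `n - l` that misses an element of each of the `l` blocks misses nothing else. With
`coTransversal_mem_bases` and `notMem_bases_of_block_subset` this identifies the bases of size `d`
with the complements of transversals. -/
theorem exists_eq_coTransversal (P : IntervalPair n l) {d : ℕ} (hd : d + l = n)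
    {I : Finset (Fin n)} (hI : I.card = d) (h : ∀ j, ∃ i ∈ P.E j, i ∉ P.C ∧ i ∉ I) :
    ∃ x, P.IsTransversal x ∧ I = coTransversal x := by
  choose x hx1 hx2 hx3 using h
  have hx : P.IsTransversal x := fun j => ⟨hx1 j, hx2 j⟩
  refine ⟨x, hx, Finset.eq_of_subset_of_card_le (fun i hi => ?_) ?_⟩
  · exact mem_coTransversal.2 fun j hj => hx3 j (hj ▸ hi)
  · rw [hx.card_coTransversal hd, hI]

end IntervalPair

/-! ### Vectors orthogonal to an element of a cell -/

theorem plucker_eq_zero_of_notMem {d n : ℕ} {A : Matrix (Fin d) (Fin n) ℝ}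
    {M : Set (Finset (Fin n))} (hA : ∀ (I : Finset (Fin n)) (hI : I.card = d),
      (I ∈ M → 0 < maxMinor A I hI) ∧ (I ∉ M → maxMinor A I hI = 0)) {I : Finset (Fin n)}
    (hI : I ∉ M) : plucker A I = 0 := by
  by_cases h : I.card = d
  · rw [plucker_eq A h, (hA I h).2 hI]
  · exact dif_neg h

theorem plucker_pos_of_mem {d n : ℕ} {A : Matrix (Fin d) (Fin n) ℝ}
    {M : Set (Finset (Fin n))} (hA : ∀ (I : Finset (Fin n)) (hI : I.card = d),
      (I ∈ M → 0 < maxMinor A I hI) ∧ (I ∉ M → maxMinor A I hI = 0)) {I : Finset (Fin n)}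
    (hI : I ∈ M) (h : I.card = d) : 0 < plucker A I := by
  rw [plucker_eq A h]
  exact (hA I h).1 hI

/-- Given `a` in a basis `I`, there is a vector `v` in the row span that is `1` at `a`, `0` on the rest
of `I`, and vanishes at every `i` for which the exchange of `a` for `i` does not give a basis. -/
theorem exists_fundamental_vector {d n : ℕ} {A : Matrix (Fin d) (Fin n) ℝ} {I : Finset (Fin n)}
    (hI : I.card = d) (hp : plucker A I ≠ 0) {a : Fin n} (ha : a ∈ I) :
    ∃ v ∈ rowSpan A, v a = 1 ∧ (∀ i ∈ I, i ≠ a → v i = 0) ∧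
      ∀ i ∉ I, plucker A ((insert i I).erase a) = 0 → v i = 0 := by
  obtain ⟨v, hv, h⟩ := exists_mem_rowSpan_of_plucker_ne_zero hp (fun i => if i = a then 1 else 0)
  have h0 : ∀ i ∈ I, i ≠ a → v i = 0 := fun i hi hia => by simpa [hia] using h i hi
  refine ⟨v, hv, by simpa using h a ha, h0, fun i hi hz => ?_⟩
  -- On `insert i I` the vector `v` lives on `a` and `i` only, so `v i` is, up to sign, the quotient
  -- of the exchanged minor by the minor of `I`.
  have h1 := two_term_relation hv (J := insert i I) (by rw [Finset.card_insert_of_notMem hi, hI])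
    (Finset.mem_insert_of_mem ha) (Finset.mem_insert_self i I) (by rintro rfl; exact hi ha)
    (fun j hj hja hji => h0 j (Finset.mem_of_mem_insert_of_ne hj hji) hja)
  rw [hz, Finset.erase_insert hi] at h1
  simpa [hp] using h1

section Cell

variable {d n l : ℕ} {P : IntervalPair n l} {A : Matrix (Fin d) (Fin n) ℝ}

/-- A coloop lies in every basis, so exchanging it never gives a basis. Its fundamental vector is
therefore the unit vector at `c`, and orthogonality to it is `w c = 0`. -/
theorem apply_coloop_eq_zero (hd : d + l = n) (hA : ∀ (I : Finset (Fin n)) (hI : I.card = d),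
      (I ∈ P.bases → 0 < maxMinor A I hI) ∧ (I ∉ P.bases → maxMinor A I hI = 0))
    {w : EuclideanSpace ℝ (Fin n)} (hw : w ∈ (rowSpan A)ᗮ) {c : Fin n} (hc : c ∈ P.C) :
    w c = 0 := by
  obtain ⟨x, hx⟩ := P.exists_isTransversal
  have hcard := hx.card_coTransversal hd
  obtain ⟨v, hv, h1, h2, h3⟩ := exists_fundamental_vector (A := A) hcard
    (plucker_pos_of_mem hA hx.coTransversal_mem_bases hcard).ne' (a := c)
    (IntervalPair.mem_coTransversal.2 fun j h => (hx j).2 (h ▸ hc))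
  have h4 := (mem_orthogonal_rowSpan_iff _ w).1 hw v hv
  rw [Finset.sum_eq_single c] at h4
  · simpa [h1] using h4
  · intro i _ hi
    by_cases h5 : i ∈ IntervalPair.coTransversal x
    · rw [h2 i h5 hi, zero_mul]
    · rw [h3 i h5, zero_mul]
      exact plucker_eq_zero_of_notMem hA
        (P.notMem_bases_of_coloop_notMem hc (Finset.notMem_erase _ _))
  · simp

/-- For a basis avoiding `b` and containing `a`, the fundamental vector of `a` is supported on `{a,
b}`. Its entry at `b` is a quotient of two positive minors times `-(-1)^(a+b)`, because all of the
block lies in `insert b I`; orthogonality to `w` then gives the relation. -/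
theorem apply_block_relation (hd : d + l = n) (hA : ∀ (I : Finset (Fin n)) (hI : I.card = d),
      (I ∈ P.bases → 0 < maxMinor A I hI) ∧ (I ∉ P.bases → maxMinor A I hI = 0))
    {w : EuclideanSpace ℝ (Fin n)} (hw : w ∈ (rowSpan A)ᗮ) {a b : Fin n} (ha : a ∉ P.C)
    (hb : b ∉ P.C) (hab : P.blk a = P.blk b) :
    ∃ t > 0, (-1) ^ (b : ℕ) * w b = t * ((-1) ^ (a : ℕ) * w a) := by
  rcases eq_or_ne a b with rfl | hne
  · exact ⟨1, one_pos, (one_mul _).symm⟩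
  obtain ⟨x, hx'⟩ := P.exists_isTransversal
  have hx := hx'.update hb
  set y := Function.update x (P.blk b) b with hy
  have hyb : y (P.blk b) = b := by simp [hy]
  set I := IntervalPair.coTransversal y with hIdef
  have hcard := hx.card_coTransversal hd
  have haI : a ∈ I := hx.mem_coTransversal_iff.2 (by rw [hab, hyb]; exact hne.symm)
  have hbI : b ∉ I := fun h => hx.mem_coTransversal_iff.1 h hyb
  have hI : 0 < plucker A I := plucker_pos_of_mem hA hx.coTransversal_mem_bases hcard
  obtain ⟨v, hv, h1, h2, h3⟩ := exists_fundamental_vector (A := A) hcard hI.ne' haI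
  have h4 := (mem_orthogonal_rowSpan_iff _ w).1 hw v hv
  have hv0 : ∀ i, i ≠ a → i ≠ b → v i = 0 := by
    intro i hia hib
    by_cases h5 : i ∈ I
    · exact h2 i h5 hia
    -- Here `i` is the transversal element of another block. Adding it fills that block, and
    -- removing `a` does not touch it, so the exchange is not a basis.
    · refine h3 i h5 (plucker_eq_zero_of_notMem hA
        (P.notMem_bases_of_block_subset (j := P.blk i) fun i' hi' _ => ?_))
      have hi : y (P.blk i) = i := not_not.1 fun h => h5 (hx.mem_coTransversal_iff.2 h)
      have hblk : P.blk i ≠ P.blk b := fun h => hib (by rw [← hi, h, hyb])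
      refine Finset.mem_erase.2 ⟨?_, Finset.mem_insert.2 ?_⟩
      · rintro rfl
        exact hblk ((P.mem_E_iff.1 hi').symm.trans hab)
      · by_cases h6 : i' = i
        · exact Or.inl h6
        · refine Or.inr (hx.mem_coTransversal_iff.2 ?_)
          rw [P.mem_E_iff.1 hi', hi]
          exact fun h => h6 h.symm
  have h5 : w a + v b * w b = 0 := by
    rw [← h4, ← Finset.sum_subset (Finset.subset_univ {a, b}), Finset.sum_pair hne, h1, one_mul]
    intro i _ hi
    simp only [Finset.mem_insert, Finset.mem_singleton, not_or] at hi
    rw [hv0 i hi.1 hi.2, zero_mul]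
  have hJ : (insert b I).card = d + 1 := by rw [Finset.card_insert_of_notMem hbI, hcard]
  have hJE : ∀ i, P.blk i = P.blk b → i ∈ insert b I := fun i hi => by
    by_cases h6 : i = b
    · exact Finset.mem_insert.2 (Or.inl h6)
    · refine Finset.mem_insert_of_mem (hx.mem_coTransversal_iff.2 ?_)
      rw [hi, hyb]
      exact fun h => h6 h.symm
  have h6 := two_term_relation' hv hJ (Finset.mem_insert_of_mem haI) (Finset.mem_insert_self b I)
    hne (fun i _ => hv0 i) (fun i hi => hJE i (by
      rcases hi with ⟨hi1, hi2⟩ | ⟨hi1, hi2⟩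
      · exact le_antisymm (P.blk_mono hi2) (hab ▸ P.blk_mono hi1)
      · exact le_antisymm (hab ▸ P.blk_mono hi2) (P.blk_mono hi1)))
  have hx2 := hx'.update ha
  -- Exchanging `a` for `b` moves the transversal from `b` to `a` within the same block, so the
  -- result is again a basis.
  have hJa : (insert b I).erase a = IntervalPair.coTransversal (Function.update x (P.blk a) a) := by
    ext i
    rw [Finset.mem_erase, Finset.mem_insert, hx.mem_coTransversal_iff, hx2.mem_coTransversal_iff]
    by_cases h7 : P.blk i = P.blk b
    · rw [h7, hyb, hab, Function.update_self]
      constructor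
      · rintro ⟨h8, -⟩
        exact fun h => h8 h.symm
      · intro h8
        exact ⟨fun h => h8 h.symm, (eq_or_ne i b).imp_right Ne.symm⟩
    · have h8 : i ≠ a := fun h => h7 (h ▸ hab)
      have h9 : i ≠ b := fun h => h7 (h ▸ rfl)
      simp [h8, h9, hy, hab, h7]
  have hpa : 0 < plucker A ((insert b I).erase a) := by
    rw [hJa]
    exact plucker_pos_of_mem hA hx2.coTransversal_mem_bases (hx2.card_coTransversal hd)
  rw [h1, Finset.erase_insert hbI] at h6
  refine ⟨plucker A I / plucker A ((insert b I).erase a), div_pos hI hpa, ?_⟩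
  rw [div_mul_eq_mul_div, eq_div_iff hpa.ne']
  have hs : ∀ i : ℕ, ((-1 : ℝ) ^ i) * (-1) ^ i = 1 := fun i => by
    rw [← pow_add, Even.neg_one_pow ⟨_, rfl⟩]
  linear_combination (-1) ^ (a : ℕ) * plucker A I * h5 * (-1) +
    ((-1) ^ (a : ℕ) * (-1) ^ (b : ℕ) * w b) * h6 -
    (-1) ^ (b : ℕ) * w b * plucker A ((insert b I).erase a) * hs a -
    (-1) ^ (a : ℕ) * v b * w b * plucker A I * hs b

end Cell

/-! ### Sign patterns of the vectors cut out by a cell -/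

theorem neg_one_pow_mul_self (i : ℕ) : ((-1 : ℝ) ^ i) * (-1) ^ i = 1 := by
  rw [← pow_add, Even.neg_one_pow ⟨_, rfl⟩]

open Classical in
/-- The number of changes of the sequence `τ 0, …, τ m`. -/
noncomputable def changes (τ : ℕ → ℝ) (m : ℕ) : ℕ :=
  ((Finset.range m).filter fun i => τ (i + 1) ≠ τ i).card

open Classical in
theorem changes_succ (τ : ℕ → ℝ) (m : ℕ) :
    changes τ (m + 1) = changes τ m + if τ (m + 1) ≠ τ m then 1 else 0 := by
  rw [changes, changes, Finset.range_add_one, Finset.filter_insert]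
  split_ifs with h
  · rw [Finset.card_insert_of_notMem (by simp)]
  · rfl

theorem neg_one_pow_changes {τ : ℕ → ℝ} (hτ : ∀ i, τ i = 1 ∨ τ i = -1) (m : ℕ) :
    (-1) ^ changes τ m = τ 0 * τ m := by
  induction m with
  | zero => rcases hτ 0 with h | h <;> simp [changes, h]
  | succ m ih =>
    rw [changes_succ, pow_add, ih]
    rcases hτ m with h | h <;> rcases hτ (m + 1) with h' | h' <;> norm_num [h, h']

/-- The signs `τ` are free wherever `w` vanishes, so this bounds the weak sign variation of `w`. The
freedom is exploited in `block_sign_alternates` and `exists_global_sign`. -/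
theorem changes_lt_of_mem_rowSpan {d n : ℕ} {A : Matrix (Fin d) (Fin n) ℝ}
    (hA : ∀ (I : Finset (Fin n)) (hI : I.card = d), 0 < maxMinor A I hI)
    {w : EuclideanSpace ℝ (Fin n)} (hw : w ∈ rowSpan A) (hw0 : w ≠ 0) {τ : ℕ → ℝ}
    (hτ : ∀ i, τ i = 1 ∨ τ i = -1) (h : ∀ i : Fin n, 0 ≤ τ i * w i) (i : Fin n) :
    changes τ i < d := by
  refine variation_lt_of_mem_rowSpan hA hw hw0 (N := changes τ) (s := τ 0) rfl (fun i => ?_)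
    (monotone_nat_of_le_succ fun i => ?_) ?_ (fun i => ?_) i
  · rw [changes_succ]
    split_ifs <;> simp
  · rw [changes_succ]
    exact Nat.le_add_right _ _
  · rcases hτ 0 with h | h <;> simp [h]
  · rw [neg_one_pow_changes hτ]
    rcases hτ 0 with h0 | h0 <;> simpa [h0] using h i

section SignPattern

variable {d n l : ℕ} {P : IntervalPair n l} {B : Matrix (Fin (d + 1)) (Fin n) ℝ}

/-- The pattern `σ (blk i) * (-1)^i` changes at each of the `n - l = d` steps inside blocks. If `σ`
agreed on blocks `j` and `j + 1`, the step between them would be one more change, and total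
positivity allows at most `d`. -/
theorem block_sign_alternates (hd : d + l = n)
    (hB : ∀ (I : Finset (Fin n)) (hI : I.card = d + 1), 0 < maxMinor B I hI)
    {w : EuclideanSpace ℝ (Fin n)} (hw : w ∈ rowSpan B) (hw0 : w ≠ 0) {σ : ℕ → ℝ}
    (hσ : ∀ j, σ j = 1 ∨ σ j = -1) (h : ∀ i : Fin n, 0 ≤ σ (P.blk i) * ((-1) ^ (i : ℕ) * w i))
    {j : ℕ} (hj : j + 1 < l) : σ (j + 1) = -σ j := by
  by_contra hne
  have hn : 0 < n := by omega
  let b : ℕ → ℕ := fun i => if hi : i < n then P.blk ⟨i, hi⟩ else 0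
  have hb : ∀ i (hi : i < n), b i = P.blk ⟨i, hi⟩ := fun i hi => dif_pos hi
  let τ : ℕ → ℝ := fun i => σ (b i) * (-1) ^ i
  have hτ : ∀ i, τ i = 1 ∨ τ i = -1 := fun i => by
    rcases hσ (b i) with h1 | h1 <;> rcases neg_one_pow_eq_or ℝ i with h2 | h2 <;> simp [τ, h1, h2]
  have hτw : ∀ i : Fin n, 0 ≤ τ i * w i := fun i => by
    simp only [τ, hb i i.2, mul_assoc]
    exact h i
  -- Of the first `i` steps, `b i` cross a block boundary and all others are changes of `τ`; the
  -- crossing from block `j` to `j + 1` is counted as an extra change.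
  have key : ∀ i, i < n → i + (if j < b i then 1 else 0) ≤ changes τ i + b i := by
    intro i
    induction i with
    | zero =>
      intro hi
      have : b 0 = 0 := (hb 0 hi).trans (P.blk_zero rfl)
      simp [this]
    | succ i ih =>
      intro hi
      have h1 := ih (by omega)
      have h2 : b i ≤ b (i + 1) := by
        rw [hb i (by omega), hb _ hi]
        exact P.blk_mono (by simp [Fin.le_def])
      have h3 : b (i + 1) ≤ b i + 1 := by
        rw [hb i (by omega), hb _ hi]
        exact P.blk_le_succ rfl
      have hpm : (-1 : ℝ) ^ i ≠ 0 := pow_ne_zero _ (by norm_num)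
      rw [changes_succ]
      by_cases h4 : b (i + 1) = b i
      · have h5 : τ (i + 1) ≠ τ i := by
          simp only [τ, h4, pow_succ]
          rcases hσ (b i) with h6 | h6 <;> rw [h6] <;> intro h7 <;> apply hpm <;> linarith
        rw [if_pos h5, h4]
        omega
      · have h4' : b (i + 1) = b i + 1 := by omega
        by_cases h5 : τ (i + 1) ≠ τ i
        · rw [if_pos h5, h4']
          split_ifs at h1 ⊢ <;> omega
        · rw [if_neg h5, h4']
          have h6 : b i ≠ j := by
            intro h6
            apply hne
            simp only [τ, h4', h6, pow_succ, not_not] at h5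
            apply mul_right_cancel₀ hpm
            linarith
          split_ifs at h1 ⊢ <;> omega
  have h1 := key (n - 1) (by omega)
  have h2 := changes_lt_of_mem_rowSpan hB hw hw0 hτ hτw ⟨n - 1, by omega⟩
  have h3 : b (n - 1) + 1 = l := by
    rw [hb _ (by omega)]
    exact P.blk_last (by simp only; omega)
  simp only at h2
  rw [if_pos (by omega)] at h1
  omega

/-- One representative per block gives a sign for the block, and `block_sign_alternates` ties these
signs to a single one. The same argument excludes vanishing representatives, which makes the
inequality strict. -/
theorem exists_global_sign (hd : d + l = n)
    (hB : ∀ (I : Finset (Fin n)) (hI : I.card = d + 1), 0 < maxMinor B I hI)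
    {w : EuclideanSpace ℝ (Fin n)} (hw : w ∈ rowSpan B) (hw0 : w ≠ 0)
    (hC : ∀ c ∈ P.C, w c = 0)
    (hR : ∀ a b, a ∉ P.C → b ∉ P.C → P.blk a = P.blk b →
      ∃ t > 0, (-1) ^ (b : ℕ) * w b = t * ((-1) ^ (a : ℕ) * w a)) :
    ∃ s : ℝ, (s = 1 ∨ s = -1) ∧
      ∀ i ∉ P.C, 0 < s * ((-1) ^ (i : ℕ) * (-1) ^ (P.blk i : ℕ) * w i) := by
  obtain ⟨x, hx⟩ := P.exists_isTransversal
  let u : ℕ → ℝ := fun j => if hj : j < l then (-1) ^ (x ⟨j, hj⟩ : ℕ) * w (x ⟨j, hj⟩) else 0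
  have hu : ∀ j : Fin l, u j = (-1) ^ (x j : ℕ) * w (x j) := fun j => dif_pos j.2
  have hut : ∀ i ∉ P.C, ∃ t > 0, (-1) ^ (i : ℕ) * w i = t * u (P.blk i) := fun i hi => by
    rw [hu]
    exact hR _ _ (hx _).2 hi (hx.blk _)
  let σ : ℕ → ℝ := fun j => if u j < 0 then -1 else 1
  have hσ : ∀ j, σ j = 1 ∨ σ j = -1 := fun j => by
    by_cases h : u j < 0 <;> simp [σ, h]
  have hσu : ∀ j, 0 ≤ σ j * u j := fun j => by
    by_cases h : u j < 0
    · simp [σ, h, h.le]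
    · simpa only [σ, if_neg h, one_mul] using not_lt.1 h
  have main : ∀ ρ : ℕ → ℝ, (∀ j, ρ j = 1 ∨ ρ j = -1) → (∀ j, 0 ≤ ρ j * u j) →
      ∀ j, j + 1 < l → ρ (j + 1) = -ρ j := by
    intro ρ hρ hρu j hj
    refine block_sign_alternates (P := P) hd hB hw hw0 hρ (fun i => ?_) hj
    by_cases hi : i ∈ P.C
    · simp [hC i hi]
    · obtain ⟨t, ht, h⟩ := hut i hi
      rw [h]
      have := mul_nonneg ht.le (hρu (P.blk i))
      linarith
  have hpm : ∀ {a : ℝ}, a = 1 ∨ a = -1 → a ≠ -a := by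
    rintro a (rfl | rfl) <;> norm_num
  -- A block with `u j = 0` could be given the sign of a neighbouring block, against `main`. If
  -- there is no neighbour, the only block vanishes and `w = 0`.
  have hu0 : ∀ j, j < l → u j ≠ 0 := by
    intro j hj h0
    have hup : ∀ j', j' ≠ j → (∀ i, 0 ≤ Function.update σ j (σ j') i * u i) ∧
        ∀ i, Function.update σ j (σ j') i = 1 ∨ Function.update σ j (σ j') i = -1 := by
      intro j' _
      constructor <;> intro i <;> by_cases hi : i = j
      · simp [hi, h0]
      · simpa [hi] using hσu i
      · simpa [hi] using hσ j'
      · simpa [hi] using hσ i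
    by_cases h1 : j + 1 < l
    · obtain ⟨h2, h3⟩ := hup (j + 1) (by omega)
      have h4 := main _ h3 h2 j h1
      rw [Function.update_self, Function.update_of_ne (by omega)] at h4
      exact hpm (hσ _) h4
    · rcases j with _ | j
      · apply hw0
        ext i
        by_cases hi : i ∈ P.C
        · simp [hC i hi]
        · obtain ⟨t, ht, h⟩ := hut i hi
          have h5 : (P.blk i : ℕ) = 0 := by
            have := (P.blk i).2
            omega
          rw [h5, h0, mul_zero] at h
          simpa using h
      · obtain ⟨h2, h3⟩ := hup j (by omega)
        have h4 := main _ h3 h2 j hj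
        rw [Function.update_self, Function.update_of_ne (by omega)] at h4
        exact hpm (hσ _) h4
  have hσj : ∀ j, j < l → σ j = (-1) ^ j * σ 0 := by
    intro j
    induction j with
    | zero => simp
    | succ j ih =>
      intro hj
      rw [main σ hσ hσu j hj, ih (by omega), pow_succ]
      ring
  refine ⟨σ 0, hσ 0, fun i hi => ?_⟩
  obtain ⟨t, ht, h⟩ := hut i hi
  have h1 := hσj _ (P.blk i).2
  have h2 : 0 < σ (P.blk i) * u (P.blk i) := lt_of_le_of_ne (hσu _)
    (mul_ne_zero (fun h => hpm (hσ _) (by rw [h, neg_zero])) (hu0 _ (P.blk i).2)).symm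
  have h3 := mul_pos ht h2
  rw [h1] at h3
  calc 0 < _ := h3
    _ = σ 0 * ((-1) ^ (P.blk i : ℕ) * (t * u (P.blk i))) := by ring
    _ = _ := by rw [← h]; ring

end SignPattern

/-! ### Cells are nonempty -/

section Nonempty

variable {d n l : ℕ} {P : IntervalPair n l} {A : Matrix (Fin d) (Fin n) ℝ}

/-- The alternating sum over a block vanishes on the row span. -/
theorem plucker_eq_zero_of_block_subset {j : Fin l}
    (hu : ∀ v ∈ rowSpan A, ∑ i ∈ P.E j \ P.C, (-1) ^ (i : ℕ) * v i = 0) {I : Finset (Fin n)}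
    (hI : P.E j \ P.C ⊆ I) : plucker A I = 0 := by
  by_contra h
  -- A nonzero minor allows `v i = (-1)^i` on `I`, and then the alternating sum equals the number of
  -- elements of `E_j \ C`, which is not zero.
  obtain ⟨v, hv, h1⟩ := exists_mem_rowSpan_of_plucker_ne_zero h (fun i => (-1) ^ (i : ℕ))
  have h2 := hu v hv
  rw [Finset.sum_congr rfl (g := fun _ => (1 : ℝ)) (fun i hi => by
    rw [h1 i (hI hi), neg_one_pow_mul_self])] at h2
  simp only [Finset.sum_const, nsmul_eq_mul, mul_one, Nat.cast_eq_zero, Finset.card_eq_zero] at h2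
  exact (P.diff_nonempty j).ne_empty h2

/-- The vector that is `1` at `a` and `0` on the rest of the basis must have entry `-(-1)^(a+b)` at
`b` by the alternating block relation. The two-term relation then says that the two minors are
equal. -/
theorem plucker_coTransversal_update (hd : d + l = n)
    (hu : ∀ j, ∀ v ∈ rowSpan A, ∑ i ∈ P.E j \ P.C, (-1) ^ (i : ℕ) * v i = 0)
    {y : Fin l → Fin n} (hy : P.IsTransversal y) {a : Fin n} (ha : a ∉ P.C)
    (hne : plucker A (IntervalPair.coTransversal y) ≠ 0) :
    plucker A (IntervalPair.coTransversal (Function.update y (P.blk a) a)) =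
      plucker A (IntervalPair.coTransversal y) := by
  set b := y (P.blk a) with hb
  have hblk : P.blk b = P.blk a := hy.blk _
  rcases eq_or_ne a b with h | hab
  · rw [h, hblk, hb, Function.update_eq_self]
  set I := IntervalPair.coTransversal y with hIdef
  have hcard : I.card = d := hy.card_coTransversal hd
  have haI : a ∈ I := hy.mem_coTransversal_iff.2 hab.symm
  have hbI : b ∉ I := fun h => hy.mem_coTransversal_iff.1 h (by rw [hblk])
  have hJE : ∀ i, P.blk i = P.blk a → i ∈ insert b I := fun i hi => by
    by_cases h : i = b
    · exact Finset.mem_insert.2 (Or.inl h)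
    · refine Finset.mem_insert_of_mem (hy.mem_coTransversal_iff.2 ?_)
      rw [hi]
      exact fun h' => h h'.symm
  obtain ⟨v, hv, h1⟩ := exists_mem_rowSpan_of_plucker_ne_zero hne (fun i => if i = a then 1 else 0)
  have hv0 : ∀ i ∈ I, i ≠ a → v i = 0 := fun i hi hia => by simpa [hia] using h1 i hi
  have hva : v a = 1 := by simpa using h1 a haI
  have h2 := hu (P.blk a) v hv
  have hbC : b ∉ P.C := (hy _).2
  rw [← Finset.sum_subset (s₁ := {a, b}), Finset.sum_pair hab, hva] at h2
  · have h3 := two_term_relation' hv (J := insert b I)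
      (by rw [Finset.card_insert_of_notMem hbI, hcard]) (Finset.mem_insert_of_mem haI)
      (Finset.mem_insert_self b I) hab
      (fun i hi hia hib => hv0 i (Finset.mem_of_mem_insert_of_ne hi hib) hia)
      (fun i hi => hJE i (by
        rcases hi with ⟨hi1, hi2⟩ | ⟨hi1, hi2⟩
        · exact le_antisymm (hblk ▸ P.blk_mono hi2) (P.blk_mono hi1)
        · exact le_antisymm (P.blk_mono hi2) (hblk ▸ P.blk_mono hi1)))
    have hup := hy.update ha
    have h4 : (insert b I).erase a =
        IntervalPair.coTransversal (Function.update y (P.blk a) a) := by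
      ext i
      rw [Finset.mem_erase, Finset.mem_insert, hy.mem_coTransversal_iff, hup.mem_coTransversal_iff]
      by_cases h7 : P.blk i = P.blk a
      · rw [h7, Function.update_self, ← hb]
        constructor
        · rintro ⟨h8, -⟩
          exact fun h => h8 h.symm
        · intro h8
          exact ⟨fun h => h8 h.symm, (eq_or_ne i b).imp_right Ne.symm⟩
      · have h8 : i ≠ a := fun h => h7 (h ▸ rfl)
        have h9 : i ≠ b := fun h => h7 (h ▸ hblk)
        simp [h8, h9, h7]
    rw [hva, Finset.erase_insert hbI, h4] at h3
    linear_combination (-1) ^ (a : ℕ) * h3 - (-1) ^ (a : ℕ) * plucker A I * h2 -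
      (plucker A (IntervalPair.coTransversal (Function.update y (P.blk a) a)) - plucker A I) *
        neg_one_pow_mul_self a
  · simp [Finset.insert_subset_iff, ha, hbC, P.mem_E_iff, hblk]
  · intro i hi hi'
    simp only [Finset.mem_insert, Finset.mem_singleton, not_or] at hi'
    rw [hv0 i (Finset.mem_of_mem_insert_of_ne
      (hJE i (P.mem_E_iff.1 (Finset.mem_sdiff.1 hi).1)) hi'.2) hi'.1, mul_zero]

theorem plucker_coTransversal_eq (hd : d + l = n)
    (hu : ∀ j, ∀ v ∈ rowSpan A, ∑ i ∈ P.E j \ P.C, (-1) ^ (i : ℕ) * v i = 0)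
    {x y : Fin l → Fin n} (hx : P.IsTransversal x) (hy : P.IsTransversal y)
    (hne : plucker A (IntervalPair.coTransversal y) ≠ 0) :
    plucker A (IntervalPair.coTransversal x) = plucker A (IntervalPair.coTransversal y) := by
  -- The transversal is changed one block at a time; `T` is the set of blocks already switched from
  -- `y` to `x`.
  have key : ∀ T : Finset (Fin l), P.IsTransversal (T.piecewise x y) ∧
      plucker A (IntervalPair.coTransversal (T.piecewise x y)) =
        plucker A (IntervalPair.coTransversal y) := by
    intro T
    induction T using Finset.induction_on with
    | empty => simpa using hy
    | insert j T _ ih =>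
      have h := hx.blk j
      have h1 := ih.1.update (hx j).2
      have h2 := plucker_coTransversal_update hd hu ih.1 (hx j).2 (by rw [ih.2]; exact hne)
      rw [h] at h1 h2
      rw [Finset.piecewise_insert]
      exact ⟨h1, h2.trans ih.2⟩
  simpa using (key Finset.univ).2

/-- The witness has all minors on bases equal to `1`. One of them is an identity block, and the
alternating block relations carry this value to every other basis and kill the nonbases. -/
theorem grassmannCell_nonempty (P : IntervalPair n l) (hd : d + l = n) :
    (grassmannCell d n P.bases).Nonempty := by
  obtain ⟨x, hx⟩ := P.exists_isTransversal
  have hc := hx.card_coTransversal hd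
  let e := (IntervalPair.coTransversal x).orderEmbOfFin hc
  have he : ∀ r, x (P.blk (e r)) ≠ e r := fun r =>
    hx.mem_coTransversal_iff.1 (Finset.orderEmbOfFin_mem _ hc r)
  -- Rows are indexed by the basis complementary to `x`: a unit vector for a coloop, otherwise a
  -- vector supported on `e r` and the transversal element of its block, signed so that its
  -- alternating block sum vanishes.
  let A : Matrix (Fin d) (Fin n) ℝ := Matrix.of fun r i =>
    if i = e r then 1 else
      if i = x (P.blk (e r)) ∧ e r ∉ P.C then -((-1) ^ (i : ℕ) * (-1) ^ (e r : ℕ)) else 0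
  have h1 : plucker A (IntervalPair.coTransversal x) = 1 := by
    rw [plucker_eq A hc, maxMinor]
    convert Matrix.det_one (n := Fin d) (R := ℝ) using 2
    ext r s
    change A r (e s) = _
    by_cases hrs : r = s
    · subst hrs
      simp [A]
    · have h2 : e s ≠ e r := fun h => hrs (e.injective h).symm
      have h3 : e s ≠ x (P.blk (e r)) := fun h => he s (by rw [h, hx.blk])
      simp [A, hrs, h2, h3]
  have hu : ∀ j, ∀ v ∈ rowSpan A, ∑ i ∈ P.E j \ P.C, (-1) ^ (i : ℕ) * v i = 0 := by
    intro j v hv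
    obtain ⟨y, hy⟩ := (mem_rowSpan_iff A v).1 hv
    have h2 : ∀ r, ∑ i ∈ P.E j \ P.C, (-1) ^ (i : ℕ) * A r i = 0 := by
      intro r
      by_cases hr : e r ∈ P.E j \ P.C
      · obtain ⟨hr1, hr2⟩ := Finset.mem_sdiff.1 hr
        have hr3 := P.mem_E_iff.1 hr1
        have hxe : e r ≠ x j := fun h => he r (by rw [hr3, h])
        rw [← Finset.sum_subset (s₁ := {e r, x j}), Finset.sum_pair hxe]
        · have := neg_one_pow_mul_self (x j)
          simp only [A, Matrix.of_apply, if_pos, hxe.symm, if_false, hr3, hr2, not_false_eq_true,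
            and_self]
          linear_combination -(-1) ^ (e r : ℕ) * this
        · simp [Finset.insert_subset_iff, hr1, hr2, hx j]
        · intro i _ hi
          simp only [Finset.mem_insert, Finset.mem_singleton, not_or] at hi
          simp [A, hi.1, hi.2, hr3]
      · refine Finset.sum_eq_zero fun i hi => ?_
        have h3 : i ≠ e r := fun h => hr (h ▸ hi)
        have h4 : ¬ (i = x (P.blk (e r)) ∧ e r ∉ P.C) := by
          rintro ⟨rfl, h4⟩
          have h5 := P.mem_E_iff.1 (Finset.mem_sdiff.1 hi).1
          rw [hx.blk] at h5
          exact hr (Finset.mem_sdiff.2 ⟨P.mem_E_iff.2 h5, h4⟩)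
        simp only [A, Matrix.of_apply, h3, h4, if_false, mul_zero]
    simp_rw [hy, Finset.mul_sum]
    rw [Finset.sum_comm]
    refine Finset.sum_eq_zero fun r _ => ?_
    have := h2 r
    calc _ = y r * ∑ i ∈ P.E j \ P.C, (-1) ^ (i : ℕ) * A r i := by
          rw [Finset.mul_sum]
          exact Finset.sum_congr rfl fun i _ => by ring
      _ = 0 := by rw [this, mul_zero]
  have hLI : LinearIndependent ℝ fun r => (WithLp.toLp 2 (A r) : EuclideanSpace ℝ (Fin n)) := by
    rw [Fintype.linearIndependent_iff]
    intro g hg r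
    have h2 := congrArg (fun v : EuclideanSpace ℝ (Fin n) => v (e r)) hg
    simp only [WithLp.ofLp_sum, WithLp.ofLp_smul, Finset.sum_apply, Pi.smul_apply, smul_eq_mul,
      PiLp.zero_apply] at h2
    rw [Finset.sum_eq_single r] at h2
    · simpa [A] using h2
    · intro s _ hs
      have h3 : e r ≠ e s := fun h => hs (e.injective h).symm
      have h4 : e r ≠ x (P.blk (e s)) := fun h => he r (by rw [h, hx.blk])
      simp [A, h3, h4]
    · simp
  refine ⟨rowSpan A, ?_, A, rfl, fun I hI => ⟨fun hmem => ?_, fun hmem => ?_⟩⟩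
  · rw [rowSpan, finrank_span_eq_card hLI, Fintype.card_fin]
  · obtain ⟨y, hy, rfl⟩ := P.exists_eq_coTransversal hd hI fun j => by
      by_contra! h
      exact P.notMem_bases_of_block_subset h hmem
    rw [← plucker_eq A hI, plucker_coTransversal_eq hd hu hy hx (by rw [h1]; exact one_ne_zero), h1]
    exact one_pos
  · have : ∃ j, P.E j \ P.C ⊆ I := by
      by_contra! h
      obtain ⟨y, hy, rfl⟩ := P.exists_eq_coTransversal hd hI fun j => by
        obtain ⟨i, hi, hiI⟩ := Finset.not_subset.1 (h j)
        exact ⟨i, (Finset.mem_sdiff.1 hi).1, (Finset.mem_sdiff.1 hi).2, hiI⟩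
      exact hmem hy.coTransversal_mem_bases
    obtain ⟨j, hj⟩ := this
    rw [← plucker_eq A hI, plucker_eq_zero_of_block_subset (hu j) hj]

end Nonempty

/-! ### Sign variation in the orthogonal complement of a nonnegative subspace -/

/-- Values on increasing tuples of unit vectors play the role of Plücker coordinates; sorting a
tuple costs only a sign. -/
theorem AlternatingMap.eq_zero_of_strictMono {n k : ℕ} {γ : (Fin n → ℝ) [⋀^Fin k]→ₗ[ℝ] ℝ}
    (h : ∀ f : Fin k → Fin n, StrictMono f → γ (fun s => Pi.single (f s) 1) = 0) : γ = 0 := by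
  refine Module.Basis.ext_alternating (Pi.basisFun ℝ (Fin n)) fun f hf => ?_
  have h1 : StrictMono (f ∘ Tuple.sort f) :=
    (Tuple.monotone_sort f).strictMono_of_injective (hf.comp (Tuple.sort f).injective)
  have h2 := γ.map_perm (fun s => Pi.single (f s) (1 : ℝ)) (Tuple.sort f)
  have h3 := h _ h1
  simp only [Function.comp_def] at h2 h3
  rw [h3] at h2
  have h4 : γ (fun s => Pi.single (f s) 1) = 0 := by
    rcases Int.units_eq_one_or (Equiv.Perm.sign (Tuple.sort f)) with h5 | h5 <;>
      simpa [h5] using h2.symm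
  simpa using h4

theorem AlternatingMap.eq_zero_of_curryLeft_eq_zero {M : Type*} [AddCommGroup M] [Module ℝ M]
    {k : ℕ} {γ : M [⋀^Fin (k + 1)]→ₗ[ℝ] ℝ} {v : M} (h : γ.curryLeft v = 0) {x : Fin (k + 1) → M}
    {s : Fin (k + 1)} (hs : x s = v) : γ x = 0 := by
  have key : ∀ y : Fin (k + 1) → M, y 0 = v → γ y = 0 := fun y hy => by
    have h1 := congrArg (fun g => g (Fin.tail y)) h
    simp only [AlternatingMap.curryLeft_apply_apply, AlternatingMap.zero_apply] at h1
    rw [← h1, ← hy]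
    exact congrArg γ (Fin.cons_self_tail y).symm
  rcases eq_or_ne 0 s with rfl | h0
  · exact key x hs
  · have h1 := γ.map_swap x h0
    rw [key _ (by simpa using hs)] at h1
    simpa using h1.symm

/-- The inclusion of the vectors with vanishing first coordinate. -/
def consZero (m : ℕ) : (Fin m → ℝ) →ₗ[ℝ] (Fin (m + 1) → ℝ) where
  toFun x := Fin.cons 0 x
  map_add' x y := by
    ext i
    refine Fin.cases ?_ (fun i => ?_) i <;> simp
  map_smul' c x := by
    ext i
    refine Fin.cases ?_ (fun i => ?_) i <;> simp

theorem consZero_single {m : ℕ} (i : Fin m) :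
    consZero m (Pi.single i 1) = Pi.single i.succ 1 := by
  ext j
  refine Fin.cases ?_ (fun j => ?_) j
  · simp [consZero, (Fin.succ_ne_zero i).symm]
  · simp [consZero, Pi.single_apply]

theorem eq_smul_single_add_consZero {m : ℕ} (x : Fin (m + 1) → ℝ) :
    x = x 0 • Pi.single 0 1 + consZero m (Fin.tail x) := by
  ext j
  refine Fin.cases ?_ (fun j => ?_) j <;> simp [consZero, Fin.tail]

/-- A tuple of unit vectors either contains the one at `0` or avoids it, so a form is determined by
its contraction and its deletion at the first coordinate. -/
theorem AlternatingMap.eq_zero_of_deletion {m k : ℕ}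
    {γ : (Fin (m + 1) → ℝ) [⋀^Fin (k + 1)]→ₗ[ℝ] ℝ} (h0 : γ.curryLeft (Pi.single 0 1) = 0)
    (h1 : γ.compLinearMap (consZero m) = 0) : γ = 0 := by
  refine AlternatingMap.eq_zero_of_strictMono fun f hf => ?_
  by_cases h : ∃ s, f s = 0
  · obtain ⟨s, hs⟩ := h
    exact AlternatingMap.eq_zero_of_curryLeft_eq_zero h0 (s := s) (by rw [hs])
  · push Not at h
    have h2 := congrArg (fun g => g (fun s => Pi.single ((f s).pred (h s)) 1)) h1
    simpa [consZero_single] using h2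

theorem AlternatingMap.eq_zero_of_contraction {m k : ℕ}
    {γ : (Fin (m + 1) → ℝ) [⋀^Fin (k + 1)]→ₗ[ℝ] ℝ}
    (h : (γ.curryLeft (Pi.single 0 1)).compLinearMap (consZero m) = 0) :
    γ.curryLeft (Pi.single 0 1) = 0 := by
  rcases k with _ | k
  · ext x
    have h1 := congrArg (fun g => g 0) h
    simp only [AlternatingMap.compLinearMap_apply, AlternatingMap.zero_apply] at h1 ⊢
    rw [← h1]
    congr 1
    exact Subsingleton.elim _ _
  · exact AlternatingMap.eq_zero_of_deletion (AlternatingMap.curryLeft_same γ _) h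

/-- A Gantmakher–Krein bound for vectors orthogonal to a nonnegative subspace, with the subspace
replaced by a nonzero alternating form with nonnegative coordinates. Decomposability is not assumed,
so deleting, contracting or merging the first coordinate stays within this class, which makes
induction on the number of coordinates possible. -/
theorem le_variation_of_curryLeft_eq_zero (n : ℕ) : ∀ (k : ℕ)
    (ω : (Fin (n + 1) → ℝ) [⋀^Fin (k + 1)]→ₗ[ℝ] ℝ) (_ : ω ≠ 0)
    (_ : ∀ f : Fin (k + 1) → Fin (n + 1), StrictMono f → 0 ≤ ω (fun s => Pi.single (f s) 1))
    (w : Fin (n + 1) → ℝ) (_ : ∀ i, w i ≠ 0) (_ : ω.curryLeft w = 0),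
    k + 1 ≤ ∑ i : Fin n, if w i.castSucc * w i.succ < 0 then 1 else 0 := by
  induction n with
  | zero =>
    intro k ω hω _ w hw hwω
    refine absurd (AlternatingMap.eq_zero_of_strictMono fun f _ => ?_) hω
    have h1 : w = w 0 • Pi.single (f 0) 1 := by
      have h2 : ∀ i : Fin (0 + 1), i = 0 := fun i => Subsingleton.elim (α := Fin 1) i 0
      ext i
      rw [h2 i, h2 (f 0)]
      simp
    rw [h1, map_smul] at hwω
    exact AlternatingMap.eq_zero_of_curryLeft_eq_zero
      ((smul_eq_zero.1 hwω).resolve_left (hw 0)) (s := 0) rfl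
  | succ n ih =>
    intro k ω hω hpos w hw hwω
    set e : Fin (n + 2) → ℝ := Pi.single 0 1 with he
    set T := consZero (n + 1) with hT
    have hwT : T (Fin.tail w) = w - w 0 • e :=
      eq_sub_of_add_eq ((add_comm _ _).trans (eq_smul_single_add_consZero w).symm)
    have hsum : (∑ i : Fin (n + 1), if w i.castSucc * w i.succ < 0 then 1 else 0) =
        (if w 0 * w 1 < 0 then 1 else 0) + ∑ i : Fin n,
          if Fin.tail w i.castSucc * Fin.tail w i.succ < 0 then 1 else 0 := by
      rw [Fin.sum_univ_succ]
      rfl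
    have htail : ∀ i, Fin.tail w i ≠ 0 := fun i => hw _
    have hw1 : w 1 ≠ 0 := hw 1
    rw [hsum]
    by_cases hsign : w 0 * w 1 < 0
    · rw [if_pos hsign]
      -- The first two entries differ in sign. If no coordinate of `ω` involves index `0`, it is
      -- deleted; otherwise contracting by `e` lowers the degree by one, which this sign change pays
      -- for.
      by_cases hdel : ω.curryLeft e = 0
      · refine (ih k (ω.compLinearMap T) (fun h => hω (AlternatingMap.eq_zero_of_deletion hdel h))
          (fun f hf => ?_) (Fin.tail w) htail ?_).trans (Nat.le_add_left _ _)
        · simp only [AlternatingMap.compLinearMap_apply, hT, consZero_single]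
          exact hpos _ ((Fin.strictMono_succ).comp hf)
        · rw [AlternatingMap.curryLeft_compLinearMap, hwT, map_sub, map_smul, hdel, hwω]
          simp
      · rcases k with _ | k
        · omega
        · have h1 := ih k ((ω.curryLeft e).compLinearMap T)
            (fun h => hdel (AlternatingMap.eq_zero_of_contraction h)) (fun f hf => ?_)
            (Fin.tail w) htail ?_
          · omega
          · simp only [AlternatingMap.compLinearMap_apply, AlternatingMap.curryLeft_apply_apply, hT,
              consZero_single]
            have h2 := hpos (Fin.cons 0 (Fin.succ ∘ f)) (by
              intro a b hab
              induction a using Fin.cases <;> induction b using Fin.cases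
              · exact absurd hab (lt_irrefl _)
              · simp
              · exact absurd hab (Fin.not_lt_zero _)
              · simpa using hf (Fin.succ_lt_succ_iff.1 hab))
            convert h2 using 2
            ext s : 1
            induction s using Fin.cases <;> rfl
          · rw [AlternatingMap.curryLeft_compLinearMap, hwT, map_sub, map_smul]
            have h2 : (ω.curryLeft e).curryLeft e = 0 := AlternatingMap.curryLeft_same ω e
            have h3 : (ω.curryLeft e).curryLeft w = 0 := by
              ext x
              simp only [AlternatingMap.curryLeft_apply_apply, AlternatingMap.zero_apply]
              exact AlternatingMap.eq_zero_of_curryLeft_eq_zero hwω (s := 1) rfl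
            rw [h2, h3]
            simp
    · have hc : 0 < w 0 / w 1 := by
        have : 0 < w 0 * w 1 := lt_of_le_of_ne (not_lt.1 hsign) (mul_ne_zero (hw 0) hw1).symm
        rcases pos_and_pos_or_neg_and_neg_of_mul_pos this with h | h
        · exact div_pos h.1 h.2
        · exact div_pos_of_neg_of_neg h.1 h.2
      set c := w 0 / w 1 with hcdef
      -- The first two entries have the same sign, so they are merged: `φ` sends the first unit
      -- vector to a positive combination of the first two and maps the tail of `w` to `w`.
      -- Positivity of `c` keeps the pulled-back form nonnegative, and no sign change is lost.
      let φ : (Fin (n + 1) → ℝ) →ₗ[ℝ] (Fin (n + 2) → ℝ) :=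
        T + c • (LinearMap.proj 0).smulRight e
      have hφ : ∀ x, φ x = T x + (c * x 0) • e := fun x => by simp [φ, smul_smul]
      have hφ0 : ∀ x : Fin (n + 1) → ℝ, x 0 = 0 → φ x = T x := fun x hx => by simp [hφ, hx]
      have hφs : ∀ i : Fin (n + 1), i ≠ 0 → φ (Pi.single i 1) = Pi.single i.succ 1 := fun i hi => by
        rw [hφ0 _ (by simp [hi.symm]), hT, consZero_single]
      have hφ1 : φ (Pi.single 0 1) = Pi.single 1 1 + c • e := by
        rw [hφ, hT, consZero_single]
        simp
      have hφw : φ (Fin.tail w) = w := by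
        have : Fin.tail w 0 = w 1 := rfl
        rw [hφ, this, hcdef, div_mul_cancel₀ _ hw1, hwT, sub_add_cancel]
      have hcons : ∀ g : Fin k → Fin n, StrictMono g → ∀ a : Fin (n + 2), a ≤ 1 →
          0 ≤ ω.curryLeft (Pi.single a 1) (fun s => Pi.single (g s).succ.succ 1) := by
        intro g hg a ha
        have h2 := hpos (Fin.cons a (fun s => (g s).succ.succ)) (by
          intro x y hxy
          induction x using Fin.cases <;> induction y using Fin.cases
          · exact absurd hxy (lt_irrefl _)
          · simp only [Fin.cons_zero, Fin.cons_succ]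
            refine lt_of_le_of_lt ha ?_
            simp [Fin.lt_def]
          · exact absurd hxy (Fin.not_lt_zero _)
          · simpa using hg (Fin.succ_lt_succ_iff.1 hxy))
        rw [AlternatingMap.curryLeft_apply_apply]
        convert h2 using 2
        ext s : 1
        induction s using Fin.cases <;> rfl
      rw [if_neg hsign, zero_add]
      refine ih k (ω.compLinearMap φ) (fun h => hω ?_) (fun f hf => ?_) (Fin.tail w) htail ?_
      · have hβ : ω.compLinearMap T = 0 := by
          refine AlternatingMap.eq_zero_of_deletion (AlternatingMap.eq_zero_of_contraction
            (AlternatingMap.eq_zero_of_strictMono fun g hg => ?_))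
            (AlternatingMap.eq_zero_of_strictMono fun g hg => ?_)
          · have h1 := congrArg (fun η => η.curryLeft (Pi.single 0 1)
              (fun s => Pi.single (g s).succ 1)) h
            simp only [AlternatingMap.curryLeft_compLinearMap, AlternatingMap.compLinearMap_apply,
              hφ1, hφs _ (Fin.succ_ne_zero _), map_add, map_smul, AlternatingMap.add_apply,
              AlternatingMap.smul_apply, AlternatingMap.curryLeft_zero, LinearMap.zero_apply,
              AlternatingMap.zero_apply, smul_eq_mul] at h1
            simp only [AlternatingMap.curryLeft_compLinearMap, AlternatingMap.compLinearMap_apply,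
              hT, consZero_single]
            have h2 := hcons g hg 1 le_rfl
            have h3 := mul_nonneg hc.le (hcons g hg 0 (Fin.zero_le _))
            exact le_antisymm (by
              change ω.curryLeft (Pi.single 1 1) _ ≤ 0
              linarith) h2
          · have h1 := congrArg (fun η => η (fun s => Pi.single (g s).succ 1)) h
            simpa [hφs _ (Fin.succ_ne_zero _), hT, consZero_single] using h1
        refine AlternatingMap.eq_zero_of_deletion (AlternatingMap.eq_zero_of_contraction ?_) hβ
        -- As `T (tail w) = w - w 0 • e` and `ω` is killed by `w`, the vanishing of the deletion
        -- forces that of the contraction by `e`.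
        have h1 := AlternatingMap.curryLeft_compLinearMap T ω (Fin.tail w)
        rw [hβ, hwT, map_sub, map_smul, hwω, AlternatingMap.curryLeft_zero] at h1
        ext x
        have h2 := congrArg (fun η => η x) h1
        simpa [hw 0] using h2
      · rw [AlternatingMap.compLinearMap_apply]
        by_cases h0 : f 0 = 0
        · have hs : ∀ s : Fin k, f s.succ ≠ 0 := fun s h => by
            have := hf (Fin.succ_pos s)
            rw [h0, h] at this
            exact lt_irrefl _ this
          let g : Fin k → Fin n := fun s => (f s.succ).pred (hs s)
          have hg : StrictMono g := fun a b hab => by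
            simpa [g] using hf (Fin.succ_lt_succ_iff.2 hab)
          have h1 : (fun s => φ (Pi.single (f s) 1)) = Matrix.vecCons (Pi.single 1 1 + c • e)
              (fun s => Pi.single (g s).succ.succ 1) := by
            ext s : 1
            induction s using Fin.cases with
            | zero => simp [h0, hφ1]
            | succ s => simp [hφs _ (hs s), g]
          rw [h1, ← AlternatingMap.curryLeft_apply_apply, map_add, map_smul]
          exact add_nonneg (hcons g hg 1 le_rfl)
            (mul_nonneg hc.le (hcons g hg 0 (Fin.zero_le _)))
        · have hs : ∀ s, f s ≠ 0 := fun s h => h0 (Fin.le_zero_iff.1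
            (h ▸ hf.monotone (Fin.zero_le s)))
          simp only [hφs _ (hs _)]
          exact hpos _ (Fin.strictMono_succ.comp hf)
      · rw [AlternatingMap.curryLeft_compLinearMap, hφw, hwω]
        simp

/-- The form `det (A x_1, …, A x_k)` has the maximal minors of `A` as coordinates, and it is killed
by `w` because `A w = 0`. -/
theorem le_changes_of_mem_orthogonal {n k : ℕ} {V : Submodule ℝ (EuclideanSpace ℝ (Fin n))}
    (hV : V ∈ nonnegGrassmannian k n) {w : EuclideanSpace ℝ (Fin n)} (hw : w ∈ Vᗮ) {τ : ℕ → ℝ}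
    (hτ : ∀ i, τ i = 1 ∨ τ i = -1) (hτw : ∀ i : Fin n, 0 < τ i * w i) :
    k ≤ changes τ (n - 1) := by
  obtain ⟨hfin, A, rfl, hA⟩ := hV
  rcases k with _ | k
  · exact Nat.zero_le _
  rcases n with _ | n
  · have := hfin.symm.trans_le (Submodule.finrank_le (rowSpan A))
    simp at this
  let ω : (Fin (n + 1) → ℝ) [⋀^Fin (k + 1)]→ₗ[ℝ] ℝ :=
    (Matrix.detRowAlternating (n := Fin (k + 1)) (R := ℝ)).compLinearMap A.mulVecLin
  have hω : ∀ x, ω x = Matrix.det (Matrix.of fun s => A.mulVec (x s)) := fun x => rfl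
  have hLI : LinearIndependent ℝ fun r => (WithLp.toLp 2 (A r) : EuclideanSpace ℝ _) := by
    rw [linearIndependent_iff_card_eq_finrank_span, Fintype.card_fin]
    exact hfin.symm
  have h1 := le_variation_of_curryLeft_eq_zero n k ω (fun h => ?_) (fun f hf => ?_) w
    (fun i h => by simpa [h] using hτw i) ?_
  · refine h1.trans_eq ?_
    rw [changes, Finset.card_filter, Nat.add_sub_cancel, Finset.sum_range]
    refine Finset.sum_congr rfl fun i _ => ?_
    have h2 := hτw i.castSucc
    have h3 := hτw i.succ
    simp only [Fin.val_castSucc, Fin.val_succ] at h2 h3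
    congr 1
    rw [eq_iff_iff]
    rcases hτ i with h4 | h4 <;> rcases hτ (i + 1) with h5 | h5 <;> rw [h4] at h2 ⊢ <;>
      rw [h5] at h3 ⊢ <;> norm_num <;> nlinarith
  -- At the rows of `A` the form is their Gram determinant. If it vanished, a nontrivial combination
  -- `z` of the rows would be orthogonal to all rows, hence to itself.
  · have h2 : ω (fun s => A s) = 0 := by rw [h]; rfl
    rw [hω, ← Matrix.exists_vecMul_eq_zero_iff] at h2
    obtain ⟨y, hy, h2⟩ := h2
    let z : Fin (n + 1) → ℝ := fun i => ∑ s, y s * A s i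
    have h3 : ∑ i, z i * z i = 0 := by
      have h4 : ∀ r, ∑ i, A r i * z i = 0 := fun r => by
        have h5 := congrFun h2 r
        simp only [Matrix.vecMul, dotProduct, Matrix.of_apply, Matrix.mulVec, Pi.zero_apply,
          Finset.mul_sum] at h5
        rw [← h5, Finset.sum_comm]
        refine Finset.sum_congr rfl fun i _ => ?_
        rw [Finset.mul_sum]
        exact Finset.sum_congr rfl fun s _ => by ring
      calc ∑ i, z i * z i = ∑ r, y r * ∑ i, A r i * z i := by
            simp_rw [Finset.mul_sum]
            rw [Finset.sum_comm]
            refine Finset.sum_congr rfl fun i _ => ?_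
            conv_lhs => enter [1]; simp only [z]
            rw [Finset.sum_mul]
            exact Finset.sum_congr rfl fun s _ => by ring
        _ = 0 := by simp [h4]
    have h4 := (Finset.sum_eq_zero_iff_of_nonneg fun i _ => mul_self_nonneg (z i)).1 h3
    refine hy (funext fun r => Fintype.linearIndependent_iff.1 hLI y ?_ r)
    ext i
    have h5 : z i = 0 := mul_self_eq_zero.1 (h4 i (Finset.mem_univ i))
    simpa [z] using h5
  · have h2 : (Finset.univ.map ⟨f, hf.injective⟩).card = k + 1 := by simp
    have h3 := hA _ h2
    rw [maxMinor_eq_det A h2 hf fun s => by simp] at h3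
    rw [hω, ← Matrix.det_transpose]
    convert h3 using 2
    ext r s
    simp
  · ext x
    rw [AlternatingMap.curryLeft_apply_apply, AlternatingMap.zero_apply, hω]
    refine Matrix.det_eq_zero_of_row_eq_zero 0 fun r => ?_
    exact (mem_orthogonal_rowSpan_iff _ w).1 hw _ (row_mem_rowSpan A r)

/-! ### Points of the amplituhedron -/

theorem mk_mem_orthImage_iff {n : ℕ} {W : Submodule ℝ (EuclideanSpace ℝ (Fin n))}
    {S : Set (Submodule ℝ (EuclideanSpace ℝ (Fin n)))} {v : W} (hv : v ≠ 0) :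
    Projectivization.mk ℝ v hv ∈ orthImage W S ↔
      ∃ V ∈ S, Submodule.span ℝ {(v : EuclideanSpace ℝ (Fin n))} = Vᗮ ⊓ W := by
  simp only [orthImage, Set.mem_ofPred_eq, Projectivization.submodule_mk, Submodule.map_span,
    Set.image_singleton, Submodule.subtype_apply]

theorem mem_orthogonal_rowSpan_of_rows {d n : ℕ} {A : Matrix (Fin d) (Fin n) ℝ}
    {w : EuclideanSpace ℝ (Fin n)} (h : ∀ r, ∑ i, A r i * w i = 0) : w ∈ (rowSpan A)ᗮ := by
  rw [mem_orthogonal_rowSpan_iff]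
  intro v hv
  obtain ⟨x, hx⟩ := (mem_rowSpan_iff A v).1 hv
  calc ∑ i, v i * w i = ∑ r, x r * ∑ i, A r i * w i := by
        simp_rw [hx, Finset.sum_mul, Finset.mul_sum, mul_assoc]
        exact Finset.sum_comm
    _ = 0 := by simp [h]

/-- A vector of a totally positive subspace of dimension `k + 1` with `k + 1` strictly alternating
entries gives a point of the amplituhedron. -/
theorem mk_mem_amplituhedron_of_alternating {n k : ℕ}
    {W : Submodule ℝ (EuclideanSpace ℝ (Fin n))} (hW : W ∈ posGrassmannian (k + 1) n) {v : W}
    (hv : v ≠ 0) {f : Fin (k + 1) → Fin n} (hf : StrictMono f) {s : ℝ}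
    (hs : ∀ j : Fin (k + 1), 0 < s * (-1) ^ (j : ℕ) * (v : EuclideanSpace ℝ (Fin n)) (f j)) :
    Projectivization.mk ℝ v hv ∈ amplituhedron k W := by
  obtain ⟨-, B, hBW, hB⟩ := hW
  set w : EuclideanSpace ℝ (Fin n) := v.1
  have hwB : w ∈ rowSpan B := hBW ▸ v.2
  have hw0 : ∀ j, w (f j) ≠ 0 := fun j h => by simpa [h] using hs j
  set t := f (Fin.last k) with ht
  -- The rows span the orthogonal complement of `w` inside the coordinate subspace of the `k + 1`
  -- chosen columns; a minor omitting column `f j` is, up to an alternating sign, `w (f j) / w t`.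
  let A : Matrix (Fin k) (Fin n) ℝ := Matrix.of fun r i =>
    if i = f r.castSucc then 1 else if i = t then -(w (f r.castSucc) / w t) else 0
  have hne : ∀ r : Fin k, f r.castSucc ≠ t := fun r h => (Fin.castSucc_lt_last r).ne (hf.injective h)
  have hA1 : ∀ r : Fin k, A r (f r.castSucc) = 1 := fun r => by simp [A]
  have hA2 : ∀ r : Fin k, A r t = -(w (f r.castSucc) / w t) := fun r => by simp [A, (hne r).symm]
  have hA0 : ∀ (r : Fin k) i, i ≠ f r.castSucc → i ≠ t → A r i = 0 := fun r i h1 h2 => by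
    simp [A, h1, h2]
  have hdot : ∀ (r : Fin k) (u : EuclideanSpace ℝ (Fin n)),
      ∑ i, A r i * u i = u (f r.castSucc) - w (f r.castSucc) / w t * u t := by
    intro r u
    rw [← Finset.sum_subset (Finset.subset_univ {f r.castSucc, t}), Finset.sum_pair (hne r), hA1,
      hA2]
    · ring
    · intro i _ hi
      simp only [Finset.mem_insert, Finset.mem_singleton, not_or] at hi
      rw [hA0 r i hi.1 hi.2, zero_mul]
  have hid : A.submatrix id (f ∘ Fin.castSucc) = 1 := by
    ext r j
    rcases eq_or_ne r j with rfl | h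
    · simp [hA1]
    · have h1 : f j.castSucc ≠ f r.castSucc := fun h1 =>
        h (Fin.castSucc_injective k (hf.injective h1)).symm
      simp [hA0 r _ h1 (hne j), h]
  set J : Finset (Fin n) := Finset.univ.map ⟨f, hf.injective⟩ with hJdef
  have hJ : J.card = k + 1 := by simp [hJdef]
  have hfJ : ∀ j, f j ∈ J := fun j => by simp [hJdef]
  have hfe : f = J.orderEmbOfFin hJ := Finset.orderEmbOfFin_unique hJ hfJ hf
  have hcard : ∀ j : Fin (k + 1), (J.filter (· < f j)).card = j := fun j => by
    rw [hfe]
    exact card_filter_lt_orderEmbOfFin hJ j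
  have hct : (J.erase t).card = k := by rw [Finset.card_erase_of_mem (hfJ _), hJ]; rfl
  have hpt : plucker A (J.erase t) = 1 := by
    rw [plucker_eq A hct, maxMinor_eq_det A hct (f := f ∘ Fin.castSucc)
      (hf.comp Fin.strictMono_castSucc) (fun r => Finset.mem_erase.2 ⟨hne r, hfJ _⟩), hid,
      Matrix.det_one]
  have hpos : ∀ j, 0 ≤ plucker A (J.erase (f j)) := by
    intro j
    induction j using Fin.lastCases with
    | last => rw [hpt]; exact zero_le_one
    | cast r =>
      have h1 := two_term_relation (row_mem_rowSpan A r) hJ (hfJ r.castSucc) (hfJ (Fin.last k))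
        (hne r) (fun i _ h1 h2 => hA0 r i h1 h2)
      rw [hcard, hcard, ← ht, hpt] at h1
      simp only [hA1, hA2, Fin.val_castSucc, Fin.val_last] at h1
      have h2 := mul_pos (hs r.castSucc) (hs (Fin.last k))
      simp only [Fin.val_castSucc, Fin.val_last, ← ht] at h2
      have h3 : plucker A (J.erase (f r.castSucc)) =
          (-1) ^ (r : ℕ) * (-1) ^ k * (w (f r.castSucc) / w t) := by
        linear_combination (-1) ^ (r : ℕ) * h1 -
          plucker A (J.erase (f r.castSucc)) * neg_one_pow_mul_self r
      have hwt : w t ≠ 0 := hw0 _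
      have h4 : 0 < s ^ 2 * w t ^ 2 * plucker A (J.erase (f r.castSucc)) := by
        rw [h3]
        calc 0 < _ := h2
          _ = _ := by field_simp
      exact (pos_of_mul_pos_right h4 (by positivity)).le
  have hLI : LinearIndependent ℝ fun r => (WithLp.toLp 2 (A r) : EuclideanSpace ℝ (Fin n)) := by
    rw [Fintype.linearIndependent_iff]
    intro g hg r
    have h2 := congrArg (fun v : EuclideanSpace ℝ (Fin n) => v (f r.castSucc)) hg
    simp only [WithLp.ofLp_sum, WithLp.ofLp_smul, Finset.sum_apply, Pi.smul_apply, smul_eq_mul,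
      PiLp.zero_apply] at h2
    rw [Finset.sum_eq_single r] at h2
    · simpa [hA1] using h2
    · intro j _ hj
      rw [hA0 j _ (fun h => hj (Fin.castSucc_injective k (hf.injective h)).symm) (hne r), mul_zero]
    · simp
  rw [amplituhedron, mk_mem_orthImage_iff]
  refine ⟨rowSpan A, ⟨by rw [rowSpan, finrank_span_eq_card hLI, Fintype.card_fin], A, rfl,
    fun I hI => ?_⟩, ?_⟩
  · by_cases hIJ : I ⊆ J
    · obtain ⟨a, ha, haI⟩ := Finset.exists_mem_notMem_of_card_lt_card
        (show I.card < J.card by omega)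
      have h1 : I = J.erase a := Finset.eq_of_subset_of_card_le
        (fun i hi => Finset.mem_erase.2 ⟨fun h => haI (h ▸ hi), hIJ hi⟩)
        (by rw [Finset.card_erase_of_mem ha, hI, hJ]; rfl)
      obtain ⟨j, -, rfl⟩ := Finset.mem_map.1 ha
      rw [← plucker_eq A hI, h1]
      exact hpos j
    · obtain ⟨i, hi, hiJ⟩ := Finset.not_subset.1 hIJ
      obtain ⟨m, rfl⟩ : i ∈ Set.range (I.orderEmbOfFin hI) := by
        rw [Finset.range_orderEmbOfFin]
        exact hi
      refine le_of_eq (Matrix.det_eq_zero_of_column_eq_zero m fun r => ?_).symm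
      exact hA0 r _ (fun h => hiJ (h ▸ hfJ _)) (fun h => hiJ (h ▸ hfJ _))
  · apply le_antisymm
    · rw [Submodule.span_singleton_le_iff_mem]
      refine ⟨mem_orthogonal_rowSpan_of_rows fun r => ?_, v.2⟩
      rw [hdot, div_mul_cancel₀ _ (hw0 _), sub_self]
    -- Orthogonality to the rows makes `u` proportional to `w` on the `k + 1` chosen columns, and
    -- these determine an element of `W`.
    · rintro u ⟨hu1, hu2⟩
      rw [Submodule.mem_span_singleton]
      refine ⟨u t / w t, ?_⟩
      rw [← sub_eq_zero]
      refine eq_zero_of_mem_rowSpan (det_submatrix_pos hB hf).ne'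
        (Submodule.sub_mem _ (Submodule.smul_mem _ _ hwB) (hBW ▸ hu2)) fun j => ?_
      simp only [PiLp.sub_apply, PiLp.smul_apply, smul_eq_mul]
      induction j using Fin.lastCases with
      | last => rw [← ht, div_mul_cancel₀ _ (hw0 _), sub_self]
      | cast r =>
        have h1 := (mem_orthogonal_rowSpan_iff _ u).1 hu1 _ (row_mem_rowSpan A r)
        simp only at h1
        rw [hdot] at h1
        linear_combination -h1

/-! ### Open sets in projective space. -/

theorem mk'_preimage_isOpen_iff {E : Type*} [AddCommGroup E] [Module ℝ E] [TopologicalSpace E]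
    (s : Set (ℙ ℝ E)) :
    IsOpen s ↔ IsOpen ((Projectivization.mk' ℝ : {v : E // v ≠ 0} → ℙ ℝ E) ⁻¹' s) :=
  isOpen_coinduced

theorem continuous_coord {n : ℕ} {W : Submodule ℝ (EuclideanSpace ℝ (Fin n))} (i : Fin n) :
    Continuous fun v : W => (v : EuclideanSpace ℝ (Fin n)) i :=
  (EuclideanSpace.proj (𝕜 := ℝ) i).continuous.comp continuous_subtype_val

theorem mk_mem_interior_of_alternating {n k : ℕ}
    {W : Submodule ℝ (EuclideanSpace ℝ (Fin n))} (hW : W ∈ posGrassmannian (k + 1) n) {v : W}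
    (hv : v ≠ 0) {f : Fin (k + 1) → Fin n} (hf : StrictMono f) {s : ℝ}
    (hs : ∀ j : Fin (k + 1), 0 < s * (-1) ^ (j : ℕ) * (v : EuclideanSpace ℝ (Fin n)) (f j)) :
    Projectivization.mk ℝ v hv ∈ interior (amplituhedron k W) := by
  -- Leaving the factor `s` free makes `U` invariant under nonzero scaling, so it is the preimage of
  -- its image in `ℙ(W)`.
  let U : Set W := {u | ∃ s : ℝ, ∀ j : Fin (k + 1),
    0 < s * (-1) ^ (j : ℕ) * (u : EuclideanSpace ℝ (Fin n)) (f j)}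
  have hU : IsOpen U := by
    have h : U = ⋃ s : ℝ, ⋂ j : Fin (k + 1),
        {u : W | 0 < s * (-1) ^ (j : ℕ) * (u : EuclideanSpace ℝ (Fin n)) (f j)} := by
      ext u
      simp [U]
    rw [h]
    exact isOpen_iUnion fun s => isOpen_iInter_of_finite fun j =>
      isOpen_lt continuous_const (continuous_const.mul (continuous_coord _))
  refine mem_interior.2 ⟨{p | ∃ (u : W) (hu : u ≠ 0), u ∈ U ∧ p = Projectivization.mk ℝ u hu},
    ?_, ?_, v, hv, ⟨s, hs⟩, rfl⟩
  · rintro p ⟨u, hu, ⟨s', hs'⟩, rfl⟩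
    exact mk_mem_amplituhedron_of_alternating hW hu hf hs'
  · rw [mk'_preimage_isOpen_iff]
    convert hU.preimage (continuous_subtype_val (p := fun v : W => v ≠ 0)) using 1
    ext u
    constructor
    · rintro ⟨u', hu', ⟨s', hs'⟩, h⟩
      rw [Projectivization.mk'_eq_mk, Projectivization.mk_eq_mk_iff'] at h
      obtain ⟨a, ha⟩ := h
      have ha0 : a ≠ 0 := by
        rintro rfl
        exact u.2 (by rw [← ha, zero_smul])
      refine ⟨s' / a, fun j => ?_⟩
      have h1 := hs' j
      rw [← ha]
      simp only [Submodule.coe_smul, PiLp.smul_apply, smul_eq_mul]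
      convert h1 using 1
      field_simp
    · intro h
      exact ⟨u, u.2, h, rfl⟩

/-! ### Cells in the interior of the amplituhedron -/

namespace IntervalPair

variable {n l : ℕ}

/-- The index of the block containing `i`, for natural numbers `i`. -/
noncomputable def blkNat (P : IntervalPair n l) (i : ℕ) : ℕ :=
  -- The value `i` beyond the range keeps `blkNat i ≤ i` everywhere and makes `i - blkNat i` drop to
  -- zero there.
  if hi : i < n then P.blk ⟨i, hi⟩ else i

theorem blkNat_val (P : IntervalPair n l) (i : Fin n) : P.blkNat i = P.blk i := dif_pos i.2

theorem blkNat_zero (P : IntervalPair n l) : P.blkNat 0 = 0 := by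
  rw [blkNat]
  split_ifs
  · exact P.blk_zero rfl
  · rfl

theorem blkNat_le_succ (P : IntervalPair n l) {i : ℕ} (hi : i + 1 < n) :
    P.blkNat i ≤ P.blkNat (i + 1) ∧ P.blkNat (i + 1) ≤ P.blkNat i + 1 := by
  rw [blkNat, blkNat, dif_pos hi, dif_pos (by omega)]
  exact ⟨P.blk_mono (by simp [Fin.le_def]), P.blk_le_succ rfl⟩

theorem blkNat_le (P : IntervalPair n l) (i : ℕ) : P.blkNat i ≤ i := by
  induction i with
  | zero => rw [P.blkNat_zero]
  | succ i ih =>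
    by_cases hi : i + 1 < n
    · have := P.blkNat_le_succ hi
      omega
    · rw [blkNat, dif_neg hi]

theorem blkNat_last (P : IntervalPair n l) (hn : 0 < n) : P.blkNat (n - 1) + 1 = l := by
  rw [blkNat, dif_pos (by omega)]
  exact P.blk_last (by simp only; omega)

/-- The sequence of signs that changes exactly within the blocks. -/
noncomputable def altSign (P : IntervalPair n l) (s : ℝ) (i : ℕ) : ℝ :=
  s * ((-1) ^ i * (-1) ^ P.blkNat i)

theorem altSign_eq_or (P : IntervalPair n l) {s : ℝ} (hs : s = 1 ∨ s = -1) (i : ℕ) :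
    P.altSign s i = 1 ∨ P.altSign s i = -1 := by
  rw [altSign]
  rcases hs with rfl | rfl <;> rcases neg_one_pow_eq_or ℝ i with h | h <;>
    rcases neg_one_pow_eq_or ℝ (P.blkNat i) with h' | h' <;> simp [h, h']

theorem altSign_succ_of_eq (P : IntervalPair n l) (s : ℝ) {i : ℕ}
    (h : P.blkNat (i + 1) = P.blkNat i) : P.altSign s (i + 1) = -P.altSign s i := by
  rw [altSign, altSign, h, pow_succ]
  ring

theorem altSign_succ_of_ne (P : IntervalPair n l) (s : ℝ) {i : ℕ} (hi : i + 1 < n)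
    (h : P.blkNat (i + 1) ≠ P.blkNat i) : P.altSign s (i + 1) = P.altSign s i := by
  have h1 := P.blkNat_le_succ hi
  have h2 : P.blkNat (i + 1) = P.blkNat i + 1 := by omega
  rw [altSign, altSign, h2, pow_succ, pow_succ]
  ring

theorem altSign_succ_ne_iff (P : IntervalPair n l) {s : ℝ} (hs : s = 1 ∨ s = -1) {i : ℕ}
    (hi : i + 1 < n) :
    P.altSign s (i + 1) ≠ P.altSign s i ↔ P.blkNat (i + 1) = P.blkNat i := by
  constructor
  · intro h
    by_contra h1
    exact h (P.altSign_succ_of_ne s hi h1)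
  · intro h
    rw [P.altSign_succ_of_eq s h]
    rcases P.altSign_eq_or hs i with h1 | h1 <;> rw [h1] <;> norm_num

/-- Every step either changes the sign or enters a new block, never both. At `m = n - 1` this leaves
`n - l` changes. -/
theorem changes_altSign (P : IntervalPair n l) {s : ℝ} (hs : s = 1 ∨ s = -1) {m : ℕ} (hm : m < n) :
    changes (P.altSign s) m + P.blkNat m = m := by
  induction m with
  | zero => simp [changes, P.blkNat_zero]
  | succ m ih =>
    have h1 := P.blkNat_le_succ hm
    have h2 := ih (by omega)
    rw [changes_succ, if_congr (P.altSign_succ_ne_iff hs hm) rfl rfl]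
    split_ifs <;> omega

/-- Flipping the sign at a coloop that is not the first element of a block other than the first
decreases the number of changes. -/
theorem changes_flip_lt (P : IntervalPair n l) {s : ℝ} (hs : s = 1 ∨ s = -1) {c : Fin n}
    (hc : c ∈ P.C) (hbad : ¬ ((∃ j, IsLeast (P.E j : Set (Fin n)) c) ∧ (c : ℕ) ≠ 0)) :
    changes (fun i => if i = c then -P.altSign s i else P.altSign s i) (n - 1) <
      changes (P.altSign s) (n - 1) := by
  classical
  have hc2 := c.2
  -- A bad coloop is neither the minimum of its block, unless it is the first index, nor the
  -- maximum, unless it is the last. So the steps on both sides of it, where they exist, stay inside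
  -- its block.
  have hprev : (c : ℕ) ≠ 0 → P.blkNat (c - 1 + 1) = P.blkNat (c - 1) := by
    intro h0
    have h1 : ¬ IsLeast (P.E (P.blk c) : Set (Fin n)) c := fun h => hbad ⟨⟨_, h⟩, h0⟩
    have h2 : ∃ i ∈ P.E (P.blk c), i < c := by
      by_contra! h
      exact h1 ⟨P.mem_blk c, fun i hi => h i hi⟩
    obtain ⟨i, hi, hic⟩ := h2
    have h3 : (c : ℕ) - 1 + 1 = c := by omega
    have h4 : P.blkNat (c - 1) = P.blk ⟨c - 1, by omega⟩ := dif_pos (by omega)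
    rw [h3, h4, P.blkNat_val]
    rw [Fin.lt_def] at hic
    refine congrArg Fin.val (le_antisymm ?_ ?_)
    · rw [← P.mem_E_iff.1 hi]
      exact P.blk_mono (by simp only [Fin.le_def]; omega)
    · exact P.blk_mono (by simp only [Fin.le_def]; omega)
  have hnext : (c : ℕ) + 1 < n → P.blkNat (c + 1) = P.blkNat c := by
    intro h0
    by_contra h1
    refine P.max_notMem (P.blk c) c ⟨P.mem_blk c, fun i hi => ?_⟩ (by omega) hc
    by_contra! h2
    rw [Fin.lt_def] at h2
    have h3 : P.blkNat (c + 1) = P.blk ⟨c + 1, h0⟩ := dif_pos h0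
    have h4 : P.blk ⟨c + 1, h0⟩ ≤ P.blk i := P.blk_mono (by simp only [Fin.le_def]; omega)
    rw [P.mem_E_iff.1 hi, Fin.le_def, ← h3, ← P.blkNat_val] at h4
    exact h1 (le_antisymm h4 (P.blkNat_le_succ h0).1)
  have hn : 1 < n := by
    by_contra h
    obtain ⟨i, hi⟩ := P.diff_nonempty (P.blk c)
    have : i = c := by
      apply Fin.ext
      omega
    exact (Finset.mem_sdiff.1 hi).2 (this ▸ hc)
  refine Finset.card_lt_card ⟨fun i hi => ?_, fun h => ?_⟩
  · simp only [Finset.mem_filter, Finset.mem_range] at hi ⊢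
    refine ⟨hi.1, (P.altSign_succ_ne_iff hs (by omega)).2 ?_⟩
    by_cases h1 : i = c
    · subst h1
      exact hnext (by omega)
    · by_cases h2 : i + 1 = c
      · have := hprev (by omega)
        rwa [← h2, Nat.add_sub_cancel] at this
      · have h3 := hi.2
        rw [if_neg h1, if_neg h2] at h3
        exact (P.altSign_succ_ne_iff hs (by omega)).1 h3
  -- A step next to `c` is a change of `altSign` but not of the flipped sequence, so the inclusion
  -- of the sets of changes is strict.
  · have key : ∀ i, i + 1 < n → P.blkNat (i + 1) = P.blkNat i → (i = c ∨ i + 1 = c) → False := by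
      intro i hi hb hic
      have h1 : i ∈ (Finset.range (n - 1)).filter fun i => P.altSign s (i + 1) ≠ P.altSign s i := by
        simp only [Finset.mem_filter, Finset.mem_range]
        exact ⟨by omega, (P.altSign_succ_ne_iff hs hi).2 hb⟩
      have h2 := (Finset.mem_filter.1 (h h1)).2
      apply h2
      beta_reduce
      rcases hic with h3 | h3
      · rw [if_neg (by omega), if_pos h3, P.altSign_succ_of_eq s hb]
      · rw [if_pos h3, if_neg (by omega), P.altSign_succ_of_eq s hb, neg_neg]
    by_cases h0 : (c : ℕ) = 0
    · exact key c (by omega) (hnext (by omega)) (Or.inl rfl)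
    · exact key (c - 1) (by omega) (hprev h0) (Or.inr (by omega))

end IntervalPair

section Interior

variable {n k : ℕ} {W : Submodule ℝ (EuclideanSpace ℝ (Fin n))}

theorem exists_altSign_of_mem_cell (hk : k ≤ n) (hW : W ∈ posGrassmannian (k + 1) n)
    (P : IntervalPair n (n - k)) {V : Submodule ℝ (EuclideanSpace ℝ (Fin n))}
    (hV : V ∈ grassmannCell k n P.bases) {w : EuclideanSpace ℝ (Fin n)} (hwV : w ∈ Vᗮ)
    (hwW : w ∈ W) (hw0 : w ≠ 0) :
    (∀ c ∈ P.C, w c = 0) ∧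
      ∃ s : ℝ, (s = 1 ∨ s = -1) ∧ ∀ i ∉ P.C, 0 < P.altSign s i * w i := by
  obtain ⟨-, B, rfl, hB⟩ := hW
  obtain ⟨-, A, rfl, hA⟩ := hV
  have hd : k + (n - k) = n := by omega
  have hC : ∀ c ∈ P.C, w c = 0 := fun c hc => apply_coloop_eq_zero hd hA hwV hc
  obtain ⟨s, hs, h⟩ := exists_global_sign hd hB hwW hw0 hC
    fun a b ha hb hab => apply_block_relation hd hA hwV ha hb hab
  refine ⟨hC, s, hs, fun i hi => ?_⟩
  rw [IntervalPair.altSign, P.blkNat_val, mul_assoc]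
  exact h i hi

theorem cell_subset_interior (hk : k < n) (hW : W ∈ posGrassmannian (k + 1) n)
    (P : IntervalPair n (n - k))
    (hP : ∀ i ∈ P.C, (∃ j, IsLeast (P.E j : Set (Fin n)) i) ∧ (i : ℕ) ≠ 0) :
    orthImage W (grassmannCell k n P.bases) ⊆ interior (amplituhedron k W) := by
  intro p hp
  rw [← p.mk_rep] at hp ⊢
  obtain ⟨V, hV, hspan⟩ := (mk_mem_orthImage_iff _).1 hp
  have hw : (p.rep : EuclideanSpace ℝ (Fin n)) ∈ Vᗮ ⊓ W :=
    hspan ▸ Submodule.mem_span_singleton_self _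
  obtain ⟨-, s, hs, h⟩ := exists_altSign_of_mem_cell hk.le hW P hV hw.1 hw.2
    (by simpa using p.rep_nonzero)
  -- On indices below `n`, `N i` counts the changes of `altSign` up to `i`; it takes all values from
  -- `0` to `k`.
  let N : ℕ → ℕ := fun i => i - P.blkNat i
  have hN1 : ∀ i, N (i + 1) ≤ N i + 1 := by
    intro i
    have h1 := P.blkNat_le i
    have h2 := P.blkNat_le (i + 1)
    by_cases hi : i + 1 < n
    · have := P.blkNat_le_succ hi
      simp only [N]
      omega
    · have h3 : P.blkNat (i + 1) = i + 1 := dif_neg hi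
      simp only [N]
      omega
  have hNmono : ∀ a b : ℕ, a ≤ b → b < n → N a ≤ N b := by
    intro a b hab
    induction b, hab using Nat.le_induction with
    | base => exact fun _ => le_rfl
    | succ b _ ih =>
      intro hb
      refine (ih (by omega)).trans ?_
      have := P.blkNat_le_succ hb
      simp only [N]
      omega
  have hNlast : N (n - 1) = k := by
    have := P.blkNat_last (by omega)
    simp only [N]
    omega
  have hex : ∀ j : Fin (k + 1), ∃ i : Fin n, N i = j ∧ i ∉ P.C := by
    intro j
    obtain ⟨i, hi, hij⟩ := exists_eq_of_le_of_succ_le (N := N) (by simp [N]) hN1 (n - 1) j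
      (by omega)
    have hin : i < n := by omega
    -- If the position found is in `C`, it is the minimum of a block and `i - 1` ends the previous
    -- one. Then `N` agrees at both, and a block maximum before the last index is not in `C`.
    by_cases hiC : (⟨i, hin⟩ : Fin n) ∈ P.C
    · obtain ⟨⟨m, hm⟩, hi0⟩ := hP _ hiC
      simp only at hi0
      have h1 : P.blk ⟨i, hin⟩ = m := P.mem_E_iff.1 hm.1
      have h2 : P.blkNat (i - 1 + 1) ≠ P.blkNat (i - 1) := by
        intro h3
        rw [Nat.sub_add_cancel (by omega)] at h3
        have h4 : P.blkNat (i - 1) = P.blk ⟨i - 1, by omega⟩ := dif_pos (by omega)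
        have h5 : P.blkNat i = m := by rw [← h1]; exact dif_pos hin
        have h6 : (⟨i - 1, by omega⟩ : Fin n) ∈ P.E m := by
          rw [P.mem_E_iff]
          apply Fin.ext
          omega
        have h7 := hm.2 h6
        simp only [Fin.le_def] at h7
        omega
      have h3 := P.blkNat_le_succ (i := i - 1) (by omega)
      refine ⟨⟨i - 1, by omega⟩, ?_, ?_⟩
      · have h4 := P.blkNat_le (i - 1)
        rw [Nat.sub_add_cancel (by omega)] at h2 h3
        simp only [N] at hij ⊢
        omega
      · refine P.max_notMem (P.blk ⟨i - 1, by omega⟩) _ ⟨P.mem_blk _, fun a ha => ?_⟩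
          (by simp only; omega)
        by_contra! h4
        rw [Fin.lt_def] at h4
        simp only at h4
        have h5 : P.blk ⟨i, hin⟩ ≤ P.blk a := P.blk_mono (by simp only [Fin.le_def]; omega)
        rw [P.mem_E_iff.1 ha, Fin.le_def] at h5
        have h6 : P.blkNat (i - 1) = P.blk ⟨i - 1, by omega⟩ := dif_pos (by omega)
        have h7 : P.blkNat i = P.blk ⟨i, hin⟩ := dif_pos hin
        rw [Nat.sub_add_cancel (by omega)] at h2 h3
        omega
    · exact ⟨⟨i, hin⟩, hij, hiC⟩
  choose f hf hfC using hex
  have hfm : StrictMono f := fun a b hab => by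
    by_contra! h1
    have := hNmono _ _ (Fin.le_def.1 h1) (f a).2
    rw [hf, hf] at this
    exact absurd hab (not_lt.2 this)
  refine mk_mem_interior_of_alternating hW _ hfm (s := s) fun j => ?_
  have h1 := h (f j) (hfC j)
  have h2 : (-1 : ℝ) ^ ((f j : ℕ)) * (-1) ^ P.blkNat (f j) = (-1) ^ (j : ℕ) := by
    have h3 := P.blkNat_le (f j)
    have h4 : ((f j : ℕ)) = j + P.blkNat (f j) := by
      have := hf j
      simp only [N] at this
      omega
    conv_lhs => enter [1, 2]; rw [h4]
    rw [pow_add, mul_assoc, neg_one_pow_mul_self, mul_one]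
  rwa [IntervalPair.altSign, h2] at h1

/-- From a bad coloop `c` and a point `w` of the cell, a small perturbation in `W` gives the zeros
of `w` the signs of `altSign`, except at `c`, where the sign is reversed. The result has fewer than
`k` changes, so it leaves the amplituhedron. -/
theorem of_cell_subset_interior (hk : k < n) (hW : W ∈ posGrassmannian (k + 1) n)
    (P : IntervalPair n (n - k))
    (hint : orthImage W (grassmannCell k n P.bases) ⊆ interior (amplituhedron k W)) :
    ∀ i ∈ P.C, (∃ j, IsLeast (P.E j : Set (Fin n)) i) ∧ (i : ℕ) ≠ 0 := by
  intro c hc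
  by_contra hbad
  have hd : k + (n - k) = n := by omega
  obtain ⟨x, hx⟩ := P.exists_isTransversal
  obtain ⟨V, hV⟩ := grassmannCell_nonempty P hd
  let h0 : Fin (n - k) := ⟨0, by omega⟩
  have hinf : Vᗮ ⊓ W ≠ ⊥ := by
    intro h
    have h1 := Submodule.finrank_add_finrank_orthogonal V
    have h2 := Submodule.finrank_sup_add_finrank_inf_eq Vᗮ W
    have h3 := Submodule.finrank_le (Vᗮ ⊔ W)
    rw [h, finrank_bot, hW.1] at h2
    rw [hV.1] at h1
    rw [finrank_euclideanSpace_fin] at h1 h3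
    omega
  obtain ⟨w, hw, hw0⟩ := Submodule.exists_mem_ne_zero_of_ne_bot hinf
  obtain ⟨hwC, s, hs, hws⟩ := exists_altSign_of_mem_cell hk.le hW P hV hw.1 hw.2 hw0
  have hxw : w (x h0) ≠ 0 := fun h => by simpa [h] using hws _ (hx h0).2
  -- A vector of `Vᗮ ⊓ W` vanishing at one index outside `C` must be zero by its sign pattern, so
  -- the intersection is a line.
  have hspan : Submodule.span ℝ {w} = Vᗮ ⊓ W := by
    apply le_antisymm
    · rw [Submodule.span_singleton_le_iff_mem]
      exact hw
    · intro u hu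
      rw [Submodule.mem_span_singleton]
      refine ⟨u (x h0) / w (x h0), ?_⟩
      by_contra hne
      have hu' : u - (u (x h0) / w (x h0)) • w ∈ Vᗮ ⊓ W :=
        Submodule.sub_mem _ hu (Submodule.smul_mem _ _ hw)
      obtain ⟨-, s', -, hs'⟩ := exists_altSign_of_mem_cell hk.le hW P hV hu'.1 hu'.2
        fun h => hne (sub_eq_zero.1 h).symm
      have := hs' _ (hx h0).2
      simp [div_mul_cancel₀ _ hxw] at this
  have hwW0 : (⟨w, hw.2⟩ : W) ≠ 0 := fun h => hw0 (congrArg Subtype.val h)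
  have hp : Projectivization.mk ℝ (⟨w, hw.2⟩ : W) hwW0 ∈ interior (amplituhedron k W) :=
    hint ((mk_mem_orthImage_iff hwW0).2 ⟨V, hV, hspan⟩)
  let τ : ℕ → ℝ := fun i => if i = c then -P.altSign s i else P.altSign s i
  have hτ : ∀ i, τ i = 1 ∨ τ i = -1 := by
    intro i
    by_cases hi : i = c
    · simp only [τ, if_pos hi]
      rcases P.altSign_eq_or hs i with h | h <;> simp [h]
    · simp only [τ, if_neg hi]
      exact P.altSign_eq_or hs i
  -- `C` lies in a set of `k + 1` columns, and all maximal minors of `W` are nonzero, so values on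
  -- `C` can be prescribed.
  obtain ⟨y, hyW, hy⟩ : ∃ y ∈ W, ∀ i ∈ P.C, y i = τ i := by
    obtain ⟨-, B, rfl, hB⟩ := hW
    have hxI : x h0 ∉ IntervalPair.coTransversal x := fun h =>
      IntervalPair.mem_coTransversal.1 h h0 rfl
    have hI : (insert (x h0) (IntervalPair.coTransversal x)).card = k + 1 := by
      rw [Finset.card_insert_of_notMem hxI, hx.card_coTransversal hd]
    obtain ⟨y, hy, h⟩ := exists_mem_rowSpan_of_plucker_ne_zero
      (by rw [plucker_eq B hI]; exact (hB _ hI).ne') (fun i => τ i)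
    exact ⟨y, hy, fun i hi => h i (Finset.mem_insert_of_mem
      (IntervalPair.mem_coTransversal.2 fun j hj => (hx j).2 (hj ▸ hi)))⟩
  let γ : ℝ → W := fun ε => ⟨w, hw.2⟩ + ε • ⟨y, hyW⟩
  have hγ : Continuous γ := by fun_prop
  have hγ0 : γ 0 = ⟨w, hw.2⟩ := by simp [γ]
  have hγi : ∀ ε i, (γ ε : EuclideanSpace ℝ (Fin n)) i = w i + ε * y i := fun ε i => rfl
  obtain ⟨U, hU, hUeq⟩ := isOpen_induced_iff.1
    ((mk'_preimage_isOpen_iff _).1 (isOpen_interior (s := amplituhedron k W)))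
  have hwU : γ 0 ∈ U := by
    have h1 : (⟨⟨w, hw.2⟩, hwW0⟩ : {v : W // v ≠ 0}) ∈ Subtype.val ⁻¹' U := by
      rw [hUeq]
      exact hp
    rw [hγ0]
    exact h1
  have hev1 : ∀ᶠ ε in nhds (0 : ℝ), γ ε ∈ U := hγ.continuousAt.eventually (hU.mem_nhds hwU)
  have hev2 : ∀ᶠ ε in nhds (0 : ℝ), ∀ i : Fin n, i ∉ P.C →
      0 < τ i * (γ ε : EuclideanSpace ℝ (Fin n)) i := by
    refine Filter.eventually_all.2 fun i => ?_
    by_cases hi : i ∈ P.C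
    · exact Filter.Eventually.of_forall fun _ h => absurd hi h
    · have hic : (i : ℕ) ≠ c := fun h => hi (Fin.ext h ▸ hc)
      have h1 : 0 < τ i * (γ 0 : EuclideanSpace ℝ (Fin n)) i := by
        rw [hγ0]
        simp only [τ, if_neg hic]
        exact hws i hi
      have h2 : Continuous fun ε => τ i * (γ ε : EuclideanSpace ℝ (Fin n)) i :=
        continuous_const.mul ((continuous_coord i).comp hγ)
      exact (h2.continuousAt.eventually (lt_mem_nhds h1)).mono fun _ h _ => h
  -- A small `ε` keeps the point in the amplituhedron and the signs off `C`; positivity of `ε` gives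
  -- the signs of `y` on `C`.
  obtain ⟨ε, ⟨hε1, hε2⟩, hε⟩ := (((hev1.and hev2).filter_mono
    (nhdsWithin_le_nhds (s := Set.Ioi 0))).and self_mem_nhdsWithin).exists
  have hpos : ∀ i : Fin n, 0 < τ i * (γ ε : EuclideanSpace ℝ (Fin n)) i := by
    intro i
    by_cases hi : i ∈ P.C
    · rw [hγi, hwC i hi, hy i hi, zero_add]
      have : (0 : ℝ) < ε := hε
      rcases hτ i with h | h <;> rw [h] <;> linarith
    · exact hε2 i hi
  have hγε : γ ε ≠ 0 := fun h => by
    have := hpos c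
    rw [h] at this
    simp at this
  have hmem : Projectivization.mk ℝ (γ ε) hγε ∈ amplituhedron k W := by
    apply interior_subset
    have h1 : (⟨γ ε, hγε⟩ : {v : W // v ≠ 0}) ∈ Subtype.val ⁻¹' U := hε1
    rw [hUeq] at h1
    exact h1
  obtain ⟨V', hV', hspan'⟩ := (mk_mem_orthImage_iff hγε).1 hmem
  have hγV : (γ ε : EuclideanSpace ℝ (Fin n)) ∈ V'ᗮ ⊓ W :=
    hspan' ▸ Submodule.mem_span_singleton_self _
  have h1 := le_changes_of_mem_orthogonal hV' hγV.1 hτ hpos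
  have h2 := P.changes_flip_lt hs hc hbad
  have h3 := P.changes_altSign hs (m := n - 1) (by omega)
  have h4 := P.blkNat_last (by omega)
  simp only [τ] at h1
  omega

end Interior

/-! ### Combinatorics of the border labels -/

namespace LeDiagram

variable {k n : ℕ}

/-- `i` labels a horizontal step of the southeast border. -/
def IsHoriz (D : LeDiagram k n) (i : ℕ) : Prop := ∃ c < n - k, D.colLabel c = i

theorem isHoriz_or_exists_rowLabel (D : LeDiagram k n) (hk : k ≤ n) {i : ℕ} (hi : i < n) :
    D.IsHoriz i ∨ ∃ r < k, D.rowLabel r = i := by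
  obtain ⟨t | t, ht⟩ := (D.labelEquiv hk).surjective ⟨i, hi⟩
  · exact Or.inr ⟨t, t.2, congrArg Fin.val ht⟩
  · exact Or.inl ⟨t, t.2, congrArg Fin.val ht⟩

theorem not_isHoriz_rowLabel (D : LeDiagram k n) {r : ℕ} (hr : r < k) :
    ¬ D.IsHoriz (D.rowLabel r) := by
  rintro ⟨c, hc, h⟩
  exact D.rowLabel_ne_colLabel ⟨r, hr⟩ ⟨c, hc⟩ h.symm

theorem rowLabel_strictMono (D : LeDiagram k n) : StrictMono D.rowLabel := fun r r' h => by
  have h1 := D.shape.rowLen_anti r r' h.le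
  unfold rowLabel
  omega

theorem rowLabel_lt' (D : LeDiagram k n) (hk : k ≤ n) {r : ℕ} (hr : r < k) : D.rowLabel r < n :=
  D.rowLabel_lt hk ⟨r, hr⟩

theorem mem_zeroRowLabels (D : LeDiagram k n) (i : Fin n) :
    i ∈ D.zeroRowLabels ↔ ∃ r < k, D.RowHasNoPlus r ∧ (i : ℕ) = D.rowLabel r := by
  simp [zeroRowLabels]

theorem lt_rowLen_of_mem_plus (D : LeDiagram k n) {r c : ℕ} (h : (r, c) ∈ D.plus) :
    c < D.shape.rowLen r :=
  YoungDiagram.mem_iff_lt_rowLen.1 (D.plus_subset h)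

theorem rowHasNoPlus_of_rowLen_eq_zero (D : LeDiagram k n) {r : ℕ} (h : D.shape.rowLen r = 0) :
    D.RowHasNoPlus r := fun c hc => by
  have := D.lt_rowLen_of_mem_plus hc
  omega

/-- Every row without a `+` has a label that is neither the first nor the last one, and that is
preceded by the label of a horizontal step. -/
def ZeroRowsFollowHoriz (D : LeDiagram k n) : Prop :=
  ∀ r < k, D.RowHasNoPlus r → D.rowLabel r ≠ 0 ∧ D.rowLabel r + 1 < n ∧
    D.IsHoriz (D.rowLabel r - 1)

/-- If the last row were empty, it would contain no `+` and its label would be the last one. -/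
theorem colLen_eq_of_zeroRowsFollowHoriz {D : LeDiagram k n} (hk : k < n)
    (h : D.ZeroRowsFollowHoriz) : D.shape.colLen 0 = k := by
  by_contra hne
  have h1 := D.colLen_le' 0
  have h2 : D.shape.rowLen (k - 1) = 0 := by
    have := D.lt_rowLen_iff (k - 1) 0
    omega
  have h3 := (h (k - 1) (by omega) (D.rowHasNoPlus_of_rowLen_eq_zero h2)).2.1
  unfold rowLabel at h3
  omega

/-- Between the vertical steps of two consecutive rows the border makes as many horizontal steps as
the row lengths differ. -/
theorem isHoriz_pred_rowLabel_iff (D : LeDiagram k n) (hk : k < n) {r : ℕ} (hr : r < k) :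
    D.rowLabel r ≠ 0 ∧ D.IsHoriz (D.rowLabel r - 1) ↔
      D.shape.rowLen r < (if r = 0 then n - k else D.shape.rowLen (r - 1)) := by
  have hlt := D.rowLabel_lt' hk.le hr
  have hle := D.rowLen_le' r
  split_ifs with h0
  · subst h0
    constructor
    · rintro ⟨h1, -⟩
      unfold rowLabel at h1
      omega
    · intro h1
      have h2 : D.rowLabel 0 ≠ 0 := by
        unfold rowLabel
        omega
      refine ⟨h2, ?_⟩
      rcases D.isHoriz_or_exists_rowLabel hk.le (i := D.rowLabel 0 - 1) (by omega) with h3 | h3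
      · exact h3
      · obtain ⟨r', _, h4⟩ := h3
        have := D.rowLabel_strictMono.monotone (Nat.zero_le r')
        omega
  · have hle' := D.rowLen_le' (r - 1)
    have hanti := D.shape.rowLen_anti (r - 1) r (by omega)
    constructor
    · rintro ⟨h1, h2⟩
      by_contra h3
      refine D.not_isHoriz_rowLabel (r := r - 1) (by omega) ?_
      have h4 : D.rowLabel (r - 1) = D.rowLabel r - 1 := by
        unfold rowLabel
        omega
      rwa [h4]
    · intro h1
      have h2 : D.rowLabel (r - 1) < D.rowLabel r - 1 := by
        unfold rowLabel
        omega
      refine ⟨by omega, ?_⟩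
      rcases D.isHoriz_or_exists_rowLabel hk.le (i := D.rowLabel r - 1) (by omega) with h3 | h3
      · exact h3
      · obtain ⟨r', _, h4⟩ := h3
        have h5 := (D.rowLabel_strictMono.lt_iff_lt (a := r - 1) (b := r')).1 (by omega)
        have h6 := (D.rowLabel_strictMono.lt_iff_lt (a := r') (b := r)).1 (by omega)
        omega

theorem rowLen_condition_iff (D : LeDiagram k n) (hk : k < n) :
    (D.shape.colLen 0 = k ∧ ∀ r < k, D.RowHasNoPlus r →
        D.shape.rowLen r < (if r = 0 then n - k else D.shape.rowLen (r - 1))) ↔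
      D.ZeroRowsFollowHoriz := by
  constructor
  · rintro ⟨h1, h2⟩ r hr hp
    obtain ⟨h3, h4⟩ := (D.isHoriz_pred_rowLabel_iff hk hr).2 (h2 r hr hp)
    refine ⟨h3, ?_, h4⟩
    have h5 := (D.lt_rowLen_iff r 0).2 (by omega)
    unfold rowLabel
    omega
  · intro h
    refine ⟨colLen_eq_of_zeroRowsFollowHoriz hk h, fun r hr hp => ?_⟩
    obtain ⟨h1, -, h2⟩ := h r hr hp
    exact (D.isHoriz_pred_rowLabel_iff hk hr).1 ⟨h1, h2⟩

/-- The block minima other than the first index are the successors of the horizontal labels, except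
that nothing after the last horizontal label is a minimum. -/
theorem intervalPair_condition_iff (D : LeDiagram k n) (hk : k < n) :
    (∀ i ∈ (D.intervalPair hk).C,
        (∃ j, IsLeast ((D.intervalPair hk).E j : Set (Fin n)) i) ∧ (i : ℕ) ≠ 0) ↔
      D.ZeroRowsFollowHoriz := by
  change (∀ i ∈ D.zeroRowLabels, (∃ j, IsLeast (D.block j : Set (Fin n)) i) ∧ (i : ℕ) ≠ 0) ↔ _
  constructor
  · intro h r hr hp
    have hlt := D.rowLabel_lt' hk.le hr
    have hnh := D.not_isHoriz_rowLabel hr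
    obtain ⟨⟨j, hj⟩, h0⟩ := h ⟨D.rowLabel r, hlt⟩ ((D.mem_zeroRowLabels _).2 ⟨r, hr, hp, rfl⟩)
    have hj2 := j.2
    have h1 := (D.mem_block j _).1 hj.1
    simp only at h0 h1
    have hj0 : (j : ℕ) ≠ 0 := by
      intro hj0
      have h2 : (⟨0, by omega⟩ : Fin n) ∈ D.block j := by
        rw [mem_block]
        exact ⟨Or.inl hj0, Or.inr (Nat.zero_le _)⟩
      have h3 := hj.2 h2
      simp only [Fin.le_def] at h3
      omega
    have h2 : D.horizLabel (j - 1) < D.rowLabel r := h1.1.resolve_left hj0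
    have h3 := D.horizLabel_mono (j := j - 1) (j' := j) (by omega) hj2
    have h4 : (⟨D.horizLabel (j - 1) + 1, by omega⟩ : Fin n) ∈ D.block j := by
      rw [mem_block]
      exact ⟨Or.inr (by simp), Or.inr (by simp only; omega)⟩
    have h5 := hj.2 h4
    have h6 := hj.2 (D.horizLabel_mem_block hk j)
    simp only [Fin.le_def] at h5 h6
    have h7 : D.rowLabel r ≠ D.horizLabel j := fun h =>
      hnh ⟨n - k - 1 - j, by omega, h.symm⟩
    have h8 := D.horizLabel_lt hk j
    exact ⟨h0, by omega, n - k - 1 - (j - 1), by omega, by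
      change D.horizLabel (j - 1) = _
      omega⟩
  · intro h i hi
    obtain ⟨r, hr, hp, hir⟩ := (D.mem_zeroRowLabels i).1 hi
    obtain ⟨h1, h2, c, hc, h3⟩ := h r hr hp
    have hcol := colLen_eq_of_zeroRowsFollowHoriz hk h
    -- Column `0` carries the last horizontal label. As no row is empty, this is the last step of
    -- the border and no vertical step follows it.
    have hc0 : c ≠ 0 := by
      rintro rfl
      unfold colLabel at h3
      omega
    have h4 : D.horizLabel (n - k - c - 1) = D.colLabel c := by
      rw [horizLabel]
      congr 1
      omega
    have h5 := D.horizLabel_mono (j := n - k - c - 1) (j' := n - k - c) (by omega) (by omega)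
    refine ⟨⟨⟨n - k - c, by omega⟩, ?_, fun i' hi' => ?_⟩, by omega⟩
    · rw [Finset.mem_coe, mem_block]
      exact ⟨Or.inr (by simp only; omega), Or.inr (by simp only; omega)⟩
    · have h6 := ((D.mem_block _ _).1 hi').1
      simp only at h6
      rw [Fin.le_def]
      omega

/-! ### The sign vector -/

theorem fullSign_eq_or (D : LeDiagram k n) (i : ℕ) : D.fullSign i = 1 ∨ D.fullSign i = -1 := by
  induction i with
  | zero => exact Or.inl rfl
  | succ i ih =>
    rw [fullSign]
    split_ifs
    · exact ih
    · rcases ih with h | h <;> rw [h]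
      · exact Or.inr rfl
      · exact Or.inl rfl

theorem fullSign_ne_zero (D : LeDiagram k n) (i : ℕ) : D.fullSign i ≠ 0 := by
  rcases D.fullSign_eq_or i with h | h <;> rw [h] <;> decide

theorem fullSign_succ_of_isHoriz (D : LeDiagram k n) {i : ℕ} (h : D.IsHoriz i) :
    D.fullSign (i + 1) = D.fullSign i := by
  rw [fullSign]
  exact if_pos h

theorem fullSign_succ_of_not_isHoriz (D : LeDiagram k n) {i : ℕ} (h : ¬ D.IsHoriz i) :
    D.fullSign (i + 1) = -D.fullSign i := by
  rw [fullSign]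
  exact if_neg h

theorem signVector_eq_zero_iff (D : LeDiagram k n) (i : Fin n) :
    D.signVector i = 0 ↔ i ∈ D.zeroRowLabels := by
  rw [signVector]
  split_ifs with h
  · simp [h]
  · simp [h, D.fullSign_ne_zero]

theorem signVector_of_notMem (D : LeDiagram k n) {i : Fin n} (h : i ∉ D.zeroRowLabels) :
    D.signVector i = D.fullSign i := if_neg h

theorem not_isHoriz_of_mem_zeroRowLabels (D : LeDiagram k n) {i : Fin n}
    (h : i ∈ D.zeroRowLabels) : ¬ D.IsHoriz i := by
  obtain ⟨r, hr, -, h⟩ := (D.mem_zeroRowLabels i).1 h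
  rw [h]
  exact D.not_isHoriz_rowLabel hr

open Classical in
/-- The sign changes of `σ(D)`. -/
noncomputable def signChanges (D : LeDiagram k n) : Finset (Fin n × Fin n) :=
  Finset.univ.filter fun p => p.1 < p.2 ∧ D.signVector p.1 ≠ 0 ∧
    D.signVector p.2 = -D.signVector p.1 ∧ ∀ j, p.1 < j → j < p.2 → D.signVector j = 0

theorem mem_signChanges (D : LeDiagram k n) (p : Fin n × Fin n) :
    p ∈ D.signChanges ↔ p.1 < p.2 ∧ D.signVector p.1 ≠ 0 ∧
      D.signVector p.2 = -D.signVector p.1 ∧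
      ∀ j, p.1 < j → j < p.2 → D.signVector j = 0 := by
  simp [signChanges]

theorem signVar_signVector (D : LeDiagram k n) (hk : k < n) :
    signVar D.signVector = D.signChanges.card := by
  rw [signVar, if_neg]
  · rfl
  · intro h
    have h1 : D.colLabel 0 < n := D.colLabel_lt hk.le ⟨0, by omega⟩
    exact D.not_isHoriz_of_mem_zeroRowLabels
      ((D.signVector_eq_zero_iff ⟨D.colLabel 0, h1⟩).1 (congrFun h _)) ⟨0, by omega, rfl⟩

/-- The index before the right end of a sign change is either a zero, hence a vertical label, or the
left end itself, where the full sign must flip. -/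
theorem not_isHoriz_of_mem_signChanges (D : LeDiagram k n) {p : Fin n × Fin n}
    (hp : p ∈ D.signChanges) : ¬ D.IsHoriz (p.2 - 1 : ℕ) := by
  obtain ⟨h1, h2, h3, h4⟩ := (D.mem_signChanges p).1 hp
  rw [Fin.lt_def] at h1
  by_cases h5 : (p.1 : ℕ) + 1 = p.2
  · intro h6
    have h7 : (p.2 - 1 : ℕ) = p.1 := by omega
    rw [h7] at h6
    have h8 := D.fullSign_succ_of_isHoriz h6
    rw [h5, ← D.signVector_of_notMem (fun h => h2 ((D.signVector_eq_zero_iff _).2 h)),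
      ← D.signVector_of_notMem, h3] at h8
    · revert h8 h2
      generalize D.signVector p.1 = t
      revert t
      decide
    · rw [← D.signVector_eq_zero_iff, h3]
      revert h2
      generalize D.signVector p.1 = t
      revert t
      decide
  · exact D.not_isHoriz_of_mem_zeroRowLabels ((D.signVector_eq_zero_iff ⟨p.2 - 1, by omega⟩).1
      (h4 _ (by simp only [Fin.lt_def]; omega) (by simp only [Fin.lt_def]; omega)))

theorem snd_injOn_signChanges (D : LeDiagram k n) : Set.InjOn Prod.snd
    (D.signChanges : Set (Fin n × Fin n)) := by
  have key : ∀ p ∈ D.signChanges, ∀ q ∈ D.signChanges, p.2 = q.2 → ¬ p.1 < q.1 := by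
    intro p hp q hq h hlt
    obtain ⟨-, -, -, h4⟩ := (D.mem_signChanges p).1 hp
    obtain ⟨h5, h6, -, -⟩ := (D.mem_signChanges q).1 hq
    exact h6 (h4 _ hlt (h ▸ h5))
  intro p hp q hq h
  exact Prod.ext (le_antisymm (not_lt.1 (key q hq p hp h.symm)) (not_lt.1 (key p hp q hq h))) h

/-- Sending a sign change to the index before its right end is injective into the `k` vertical
labels. So there are `k` changes exactly when every vertical label is reached. -/
theorem signVar_eq_iff_forall_exists (D : LeDiagram k n) (hk : k < n) :
    signVar D.signVector = k ↔
      ∀ r < k, ∃ p ∈ D.signChanges, (p.2 : ℕ) = D.rowLabel r + 1 := by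
  rw [D.signVar_signVector hk, Nat.cast_inj]
  set S := D.signChanges.image fun p => (p.2 - 1 : ℕ) with hS
  set R := (Finset.range k).image D.rowLabel with hR
  have hp2 : ∀ p ∈ D.signChanges, 0 < (p.2 : ℕ) := fun p hp =>
    (Nat.zero_le _).trans_lt ((D.mem_signChanges p).1 hp).1
  have hcS : S.card = D.signChanges.card := by
    refine Finset.card_image_of_injOn fun p hp q hq h => D.snd_injOn_signChanges hp hq ?_
    have h1 := hp2 p hp
    have h2 := hp2 q hq
    exact Fin.ext (by omega)
  have hcR : R.card = k := by
    rw [hR, Finset.card_image_of_injective _ D.rowLabel_strictMono.injective, Finset.card_range]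
  have hSR : S ⊆ R := by
    intro i hi
    obtain ⟨p, hp, rfl⟩ := Finset.mem_image.1 hi
    rcases D.isHoriz_or_exists_rowLabel hk.le (i := (p.2 - 1 : ℕ)) (by omega) with h | h
    · exact absurd h (D.not_isHoriz_of_mem_signChanges hp)
    · obtain ⟨r, hr, h⟩ := h
      exact Finset.mem_image.2 ⟨r, Finset.mem_range.2 hr, h⟩
  rw [← hcS]
  constructor
  · intro h r hr
    have h1 : D.rowLabel r ∈ S := by
      rw [Finset.eq_of_subset_of_card_le hSR (by omega)]
      exact Finset.mem_image.2 ⟨r, Finset.mem_range.2 hr, rfl⟩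
    obtain ⟨p, hp, h2⟩ := Finset.mem_image.1 h1
    have := hp2 p hp
    exact ⟨p, hp, by omega⟩
  · intro h
    refine (congrArg Finset.card (Finset.Subset.antisymm hSR fun i hi => ?_)).trans hcR
    obtain ⟨r, hr, rfl⟩ := Finset.mem_image.1 hi
    obtain ⟨p, hp, h1⟩ := h r (Finset.mem_range.1 hr)
    exact Finset.mem_image.2 ⟨p, hp, by omega⟩

theorem signVar_eq_iff (D : LeDiagram k n) (hk : k < n) :
    signVar D.signVector = k ↔ D.ZeroRowsFollowHoriz := by
  rw [D.signVar_eq_iff_forall_exists hk]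
  have hneg : ∀ t : SignType, t ≠ 0 → -t ≠ 0 := by decide
  constructor
  · intro h
    -- The right end of a sign change is nonzero, so no zero-row label directly follows a vertical
    -- label.
    have hsucc : ∀ r < k, ∀ i : Fin n, (i : ℕ) = D.rowLabel r + 1 → i ∉ D.zeroRowLabels := by
      intro r hr i hi
      obtain ⟨p, hp, h1⟩ := h r hr
      obtain ⟨-, h2, h3, -⟩ := (D.mem_signChanges p).1 hp
      have h4 : i = p.2 := Fin.ext (by omega)
      rw [← D.signVector_eq_zero_iff, h4, h3]
      exact hneg _ h2
    intro r hr hp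
    have hlt := D.rowLabel_lt' hk.le hr
    have hC : (⟨D.rowLabel r, hlt⟩ : Fin n) ∈ D.zeroRowLabels :=
      (D.mem_zeroRowLabels _).2 ⟨r, hr, hp, rfl⟩
    obtain ⟨p, hpS, h1⟩ := h r hr
    obtain ⟨h2, h3, -, -⟩ := (D.mem_signChanges p).1 hpS
    have h0 : D.rowLabel r ≠ 0 := by
      intro h0
      rw [Fin.lt_def] at h2
      refine h3 ((D.signVector_eq_zero_iff _).2 ?_)
      have : p.1 = ⟨D.rowLabel r, hlt⟩ := Fin.ext (by simp only; omega)
      rwa [this]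
    refine ⟨h0, by have := p.2.2; omega, ?_⟩
    rcases D.isHoriz_or_exists_rowLabel hk.le (i := D.rowLabel r - 1) (by omega) with h4 | h4
    · exact h4
    · obtain ⟨r', hr', h5⟩ := h4
      exact absurd hC (hsucc r' hr' _ (by simp only; omega))
  · intro h r hr
    have hlt := D.rowLabel_lt' hk.le hr
    have hnh := D.not_isHoriz_rowLabel hr
    have hsucc : ∀ i : Fin n, (i : ℕ) = D.rowLabel r + 1 → i ∉ D.zeroRowLabels := by
      intro i hi hiC
      obtain ⟨r', hr', hp', hi'⟩ := (D.mem_zeroRowLabels i).1 hiC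
      have h1 := (h r' hr' hp').2.2
      rw [← hi', hi] at h1
      exact hnh h1
    by_cases hp : D.RowHasNoPlus r
    · obtain ⟨h1, h2, h3⟩ := h r hr hp
      -- The zero is isolated: the full sign is kept over the horizontal step before it and flips
      -- over the vertical step itself, so the two neighbours are opposite.
      refine ⟨(⟨D.rowLabel r - 1, by omega⟩, ⟨D.rowLabel r + 1, h2⟩), ?_, rfl⟩
      have h4 : (⟨D.rowLabel r - 1, by omega⟩ : Fin n) ∉ D.zeroRowLabels := fun h4 =>
        D.not_isHoriz_of_mem_zeroRowLabels h4 h3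
      rw [mem_signChanges]
      simp only
      rw [D.signVector_of_notMem h4, D.signVector_of_notMem (hsucc ⟨_, h2⟩ rfl)]
      refine ⟨by simp only [Fin.lt_def]; omega, D.fullSign_ne_zero _, ?_, fun j hj1 hj2 => ?_⟩
      · simp only
        rw [D.fullSign_succ_of_not_isHoriz hnh, ← D.fullSign_succ_of_isHoriz h3,
          Nat.sub_add_cancel (by omega)]
      · rw [signVector_eq_zero_iff, mem_zeroRowLabels]
        simp only [Fin.lt_def] at hj1 hj2
        exact ⟨r, hr, hp, by omega⟩
    · have h2 : D.rowLabel r + 1 < n := by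
        simp only [RowHasNoPlus, not_forall, not_not] at hp
        obtain ⟨c, hc⟩ := hp
        have h1 := D.lt_rowLen_of_mem_plus hc
        have := D.rowLen_le' r
        unfold rowLabel
        omega
      refine ⟨(⟨D.rowLabel r, hlt⟩, ⟨D.rowLabel r + 1, h2⟩), ?_, rfl⟩
      have h4 : (⟨D.rowLabel r, hlt⟩ : Fin n) ∉ D.zeroRowLabels := by
        rw [mem_zeroRowLabels]
        rintro ⟨r', _, hp', h5⟩
        exact hp (D.rowLabel_strictMono.injective h5 ▸ hp')
      rw [mem_signChanges]
      simp only
      rw [D.signVector_of_notMem h4, D.signVector_of_notMem (hsucc ⟨_, h2⟩ rfl)]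
      refine ⟨by simp [Fin.lt_def], D.fullSign_ne_zero _,
        D.fullSign_succ_of_not_isHoriz hnh, fun j hj1 hj2 => ?_⟩
      simp only [Fin.lt_def] at hj1 hj2
      omega

/-! ### Pipes -/

/-- Pipes only run north and west. The inequality is strict for a horizontal edge because `horiz r'
c'` is the top side of row `r'`. -/
theorem row_le_of_pipeFrom_vert (D : LeDiagram k n) {e : Edge} {r : ℕ}
    (h : D.PipeFrom e (.vert r 0)) :
    (∀ r' c', e = .vert r' c' → r ≤ r') ∧ ∀ r' c', e = .horiz r' c' → r < r' := by
  induction h using Relation.ReflTransGen.head_induction_on with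
  | refl => simp
  | @head e f hs _ ih =>
    rcases e with ⟨r', _ | c'⟩ | ⟨_ | r', c'⟩ <;>
      simp only [nextEdge, Option.some.injEq, reduceCtorEq] at hs <;> subst hs <;>
      split_ifs at ih <;> simp at ih ⊢ <;> omega

theorem col_le_of_pipeFrom_horiz (D : LeDiagram k n) {e : Edge} {c : ℕ}
    (h : D.PipeFrom e (.horiz 0 c)) :
    (∀ r' c', e = .vert r' c' → c < c') ∧ ∀ r' c', e = .horiz r' c' → c ≤ c' := by
  induction h using Relation.ReflTransGen.head_induction_on with
  | refl => simp
  | @head e f hs _ ih =>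
    rcases e with ⟨r', _ | c'⟩ | ⟨_ | r', c'⟩ <;>
      simp only [nextEdge, Option.some.injEq, reduceCtorEq] at hs <;> subst hs <;>
      split_ifs at ih <;> simp at ih ⊢ <;> omega

theorem pipeFrom_vert_of_rowHasNoPlus (D : LeDiagram k n) {r : ℕ} (h : D.RowHasNoPlus r) (c : ℕ) :
    D.PipeFrom (.vert r c) (.vert r 0) := by
  induction c with
  | zero => exact Relation.ReflTransGen.refl
  | succ c ih => exact Relation.ReflTransGen.head (by simp [nextEdge, h c]) ih

theorem eq_of_pipeFrom_oppositeEdge (D : LeDiagram k n) {t : Fin k ⊕ Fin (n - k)} {f : Edge}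
    (h : D.PipeFrom (oppositeEdge t) f) : f = oppositeEdge t := by
  rcases Relation.ReflTransGen.cases_head h with h | ⟨g, hg, -⟩
  · exact h.symm
  · rw [nextEdge_oppositeEdge] at hg
    exact absurd hg (by simp)

/-- `pipeEnd` is obtained by choice, so computing it requires that a pipe has only one exit. -/
theorem oppositeEdge_eq_of_pipeFrom (D : LeDiagram k n) {e : Edge} {t t' : Fin k ⊕ Fin (n - k)}
    (h : D.PipeFrom e (oppositeEdge t)) (h' : D.PipeFrom e (oppositeEdge t')) : t = t' := by
  apply oppositeEdge_injective
  induction h using Relation.ReflTransGen.head_induction_on with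
  | refl => exact (D.eq_of_pipeFrom_oppositeEdge h').symm
  | head hs _ ih =>
    rcases Relation.ReflTransGen.cases_head h' with h1 | ⟨g, hg, h1⟩
    · rw [h1, nextEdge_oppositeEdge] at hs
      exact absurd hs (by simp)
    · rw [hs, Option.some.injEq] at hg
      subst hg
      exact ih h1

/-- A `+` at the right end of the row turns the pipe north at once, and it never comes back down.
Without a `+` the pipe runs straight to the west border. -/
theorem pipeEnd_inl_eq_iff {D : LeDiagram k n} (hD : D.InDBar) (r : Fin k) :
    D.pipeEnd (Sum.inl r) = Sum.inl r ↔ D.RowHasNoPlus r := by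
  have h1 := D.pipeFrom_pipeEnd (Sum.inl r)
  constructor
  · intro h c hc
    rw [h] at h1
    have h2 : D.borderEdge (Sum.inl r) = .vert r (c + 1) := by rw [borderEdge, hD.2 _ _ hc]
    rw [h2] at h1
    rcases Relation.ReflTransGen.cases_head h1 with h3 | ⟨g, hg, h3⟩
    · simp [oppositeEdge] at h3
    · simp only [nextEdge, if_pos hc, Option.some.injEq] at hg
      subst hg
      exact lt_irrefl _ ((D.row_le_of_pipeFrom_vert h3).2 _ _ rfl)
  · intro h
    exact D.oppositeEdge_eq_of_pipeFrom h1 (D.pipeFrom_vert_of_rowHasNoPlus h _)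

theorem mem_white_iff {D : LeDiagram k n} (hD : D.InDBar) (hk : k ≤ n) (i : Fin n) :
    i ∈ (D.decoratedPermutation hk).white ↔ i ∈ D.zeroRowLabels := by
  rw [mem_zeroRowLabels]
  constructor
  · rintro ⟨r, rfl, h⟩
    exact ⟨r, r.2, (pipeEnd_inl_eq_iff hD r).1 h, rfl⟩
  · rintro ⟨r, hr, h, hi⟩
    exact ⟨⟨r, hr⟩, Fin.ext hi.symm, (pipeEnd_inl_eq_iff hD ⟨r, hr⟩).2 h⟩

theorem perm_label (D : LeDiagram k n) (hk : k ≤ n) (s : Fin k ⊕ Fin (n - k)) :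
    (D.decoratedPermutation hk).perm (D.label hk s) = D.label hk (D.pipeEnd s) := by
  have h : D.label hk s = D.labelEquiv hk s := rfl
  rw [h]
  simp [decoratedPermutation, Equiv.permCongr_apply, labelEquiv]

/-- A pipe leaving through the west side of row `r` started no earlier on the border than that row's
own step; if it started at that step, the fixed point is white. With the horizontal counterpart this
shows that anti-excedances are exactly the vertical labels. -/
theorem isAntiExcedance_label_inl (D : LeDiagram k n) (hk : k ≤ n) (r : Fin k) :
    (D.decoratedPermutation hk).IsAntiExcedance (D.label hk (Sum.inl r)) := by
  obtain ⟨s, hs⟩ := (Finite.injective_iff_surjective.1 D.pipeEnd_injective) (Sum.inl r)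
  have h1 : (D.decoratedPermutation hk).perm.symm (D.label hk (Sum.inl r)) = D.label hk s := by
    rw [Equiv.symm_apply_eq, perm_label, hs]
  rw [DecoratedPermutation.IsAntiExcedance, h1]
  have h2 := D.pipeFrom_pipeEnd s
  rw [hs] at h2
  rcases s with r' | c
  · have h3 : (r : ℕ) ≤ r' := (D.row_le_of_pipeFrom_vert h2).1 _ _ rfl
    rcases h3.lt_or_eq with h4 | h4
    · exact Or.inl (D.rowLabel_strictMono h4)
    · obtain rfl : r = r' := Fin.ext h4
      exact Or.inr ⟨r, rfl, hs⟩
  · left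
    have h3 : (r : ℕ) < D.shape.colLen c := (D.row_le_of_pipeFrom_vert h2).2 _ _ rfl
    have h4 := (D.lt_rowLen_iff r c).2 h3
    have h5 := D.rowLen_le' r
    change D.rowLabel r < D.colLabel c
    unfold rowLabel colLabel
    omega

theorem not_isAntiExcedance_label_inr (D : LeDiagram k n) (hk : k ≤ n) (c : Fin (n - k)) :
    ¬ (D.decoratedPermutation hk).IsAntiExcedance (D.label hk (Sum.inr c)) := by
  obtain ⟨s, hs⟩ := (Finite.injective_iff_surjective.1 D.pipeEnd_injective) (Sum.inr c)
  have h1 : (D.decoratedPermutation hk).perm.symm (D.label hk (Sum.inr c)) = D.label hk s := by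
    rw [Equiv.symm_apply_eq, perm_label, hs]
  rw [DecoratedPermutation.IsAntiExcedance, h1]
  have h2 := D.pipeFrom_pipeEnd s
  rw [hs] at h2
  rintro (h | ⟨r, hr, -⟩)
  · rcases s with r | c'
    · have h3 : (c : ℕ) < D.shape.rowLen r := (D.col_le_of_pipeFrom_horiz h2).1 _ _ rfl
      have h4 := (D.lt_rowLen_iff r c).1 h3
      have h5 := D.rowLen_le' r
      have h6 : D.colLabel c < D.rowLabel r := h
      unfold rowLabel colLabel at h6
      omega
    · have h3 : (c : ℕ) ≤ c' := (D.col_le_of_pipeFrom_horiz h2).2 _ _ rfl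
      have h4 := D.shape.colLen_anti _ _ h3
      have h6 : D.colLabel c < D.colLabel c' := h
      unfold colLabel at h6
      omega
  · exact absurd (D.label_injective hk hr) (by simp)

theorem isAntiExcedance_iff (D : LeDiagram k n) (hk : k ≤ n) (i : Fin n) :
    (D.decoratedPermutation hk).IsAntiExcedance i ↔ ¬ D.IsHoriz i := by
  obtain ⟨t, rfl⟩ : ∃ t, D.label hk t = i := (D.labelEquiv hk).surjective i
  rcases t with r | c
  · exact iff_of_true (D.isAntiExcedance_label_inl hk r) (D.not_isHoriz_rowLabel r.2)
  · exact iff_of_false (D.not_isAntiExcedance_label_inr hk c) (not_not.2 ⟨c, c.2, rfl⟩)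

theorem white_condition_iff {D : LeDiagram k n} (hD : D.InDBar) (hk : k < n) :
    (∀ i ∈ (D.decoratedPermutation hk.le).white, 0 < (i : ℕ) ∧ (i : ℕ) + 1 < n ∧
        ∀ i' : Fin n, (i' : ℕ) + 1 = (i : ℕ) →
          ¬ (D.decoratedPermutation hk.le).IsAntiExcedance i') ↔ D.ZeroRowsFollowHoriz := by
  simp only [mem_white_iff hD, isAntiExcedance_iff, not_not]
  constructor
  · intro h r hr hp
    have hlt := D.rowLabel_lt' hk.le hr
    obtain ⟨h1, h2, h3⟩ := h ⟨D.rowLabel r, hlt⟩ ((D.mem_zeroRowLabels _).2 ⟨r, hr, hp, rfl⟩)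
    simp only at h1 h2 h3
    exact ⟨by omega, h2, h3 ⟨D.rowLabel r - 1, by omega⟩ (by simp only; omega)⟩
  · intro h i hi
    obtain ⟨r, hr, hp, hir⟩ := (D.mem_zeroRowLabels i).1 hi
    obtain ⟨h1, h2, h3⟩ := h r hr hp
    refine ⟨by omega, by omega, fun i' hi' => ?_⟩
    have h4 : (i' : ℕ) = D.rowLabel r - 1 := by omega
    rwa [h4]

end LeDiagram

/-! ### Assembling the equivalences. -/

theorem mainTheorem8 (n k : ℕ) (hk : k < n) (W : Submodule ℝ (EuclideanSpace ℝ (Fin n)))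
    (hW : W ∈ posGrassmannian (k + 1) n) (D : LeDiagram k n) (hD : D.InDBar) :
    List.TFAE [
      amplituhedronCell hk W D ⊆ interior (amplituhedron k W),
      D.shape.colLen 0 = k ∧ ∀ r < k, D.RowHasNoPlus r →
        D.shape.rowLen r < (if r = 0 then n - k else D.shape.rowLen (r - 1)),
      signVar D.signVector = k,
      ∃ P : IntervalPair n (n - k), P.bases = D.positroid hk ∧
        ∀ i ∈ P.C, (∃ j, IsLeast (P.E j : Set (Fin n)) i) ∧ (i : ℕ) ≠ 0,
      ∀ i ∈ (D.decoratedPermutation hk.le).white, 0 < (i : ℕ) ∧ (i : ℕ) + 1 < n ∧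
        ∀ i' : Fin n, (i' : ℕ) + 1 = (i : ℕ) →
          ¬ (D.decoratedPermutation hk.le).IsAntiExcedance i'] := by
  tfae_have 2 ↔ 3 := (D.rowLen_condition_iff hk).trans (D.signVar_eq_iff hk).symm
  tfae_have 2 ↔ 5 := (D.rowLen_condition_iff hk).trans (LeDiagram.white_condition_iff hD hk).symm
  tfae_have 1 → 2 := fun h => (D.rowLen_condition_iff hk).2
    ((D.intervalPair_condition_iff hk).1 (of_cell_subset_interior hk hW (D.intervalPair hk) h))
  tfae_have 2 → 4 := fun h => ⟨D.intervalPair hk, rfl,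
    (D.intervalPair_condition_iff hk).2 ((D.rowLen_condition_iff hk).1 h)⟩
  tfae_have 4 → 1 := by
    -- The cell depends only on the set of bases, so any pair with the bases of `M(D)` serves, not
    -- only the one read off from `D`.
    rintro ⟨P, hP, h⟩
    rw [amplituhedronCell, ← hP]
    exact cell_subset_interior hk hW P h
  tfae_finish
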